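/- Let $P(\lambda)=\sum_{i=0}^d P_i\lambda^i$ be an $m\times n$ complex polynomial matrix of degree at most $d$ and of normal rank $r$ (its rank over $\mathbb{C}(\lambda)$). Let $S_P(\lambda)$ be its generalized state-space system matrix $$S_P(\lambda)=\left[\begin{array}{ccccc|c} I_n & -\lambda I_n & & & & \\ & I_n & -\lambda I_n & & & \\ & & \ddots & \ddots & & \\ & & & I_n & -\lambda I_n & \\ & & & & I_n & -I_n \\ \hline P_d & \ldots & \ldots & P_1 & P_0 & 0\end{array}\right].$$ Then $r\le n$, and there exist a feedback matrix $F\in\mathbb{C}^{n\times(d+1)n}$ and unitary matrices $Q\in\mathbb{C}^{dn\times dn}$, $Z\in\mathbb{C}^{(d+1)n\times(d+1)n}$ such that $$\left[\begin{array}{cc|c} Q^* & & \\ & I_n & \\ \hline & & I_m\end{array}\right] S_P(\lambda)\left[\begin{array}{c|c} Z & \\ \hline FZ & I_n\end{array}\right]=\left[\begin{array}{cccc|cc} A_{11}-\lambda E_{11} & A_{12}-\lambda E_{12} & A_{13}-\lambda E_{13} & A_{14}-\lambda E_{14} & 0 & 0\\ 0 & A_{22}-\lambda E_{22} & A_{23}-\lambda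 E_{23} & A_{24}-\lambda E_{24} & 0 & 0\\ 0 & 0 & A_{33}-\lambda E_{33} & A_{34}-\lambda E_{34} & 0 & 0\\ 0 & 0 & Z_3 & Z_4 & -I_r & 0\\ Z_1 & 0 & 0 & 0 & 0 & -I_{n-r}\\ \hline 0 & 0 & 0 & C_4 & 0 & 0\end{array}\right]$$ with constant complex matrices $A_{ij},E_{ij},Z_i,C_4$ (blocks may be empty). Call the left $(d+1)n$ columns of the right-hand side the state columns; write $T(\lambda)$ for the state pencil (the upper $(d+1)n$ rows of the state columns) and $K=[\,0\;\;0\;\;0\;\;C_4\,]$ for the output matrix. Call a square subpencil $H(\lambda)$ of order $k$ *unobservable* in this realization if there are constant matrices $R,L$ with $k$ columns and rank $k$ such that $T(\lambda)R=L\,H(\lambda)$ and $KR=0$. The decomposition can be chosen so that: 1. $A_{22}-\lambda E_{22}$ is square with $E_{22}$ invertible. It contains the finite zeros of $P(\lambda)$: the invariant polynomials different from $1$ in the Smith forms of $A_{22}-\lambda E_{22}$ and of $P(\lambda)$ are the same. It is unobservable in this realization. 2. $A_{11}-\lambda E_{11}$ has only right Kronecker blocks, that is, $A_{11}-\alpha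 E_{11}$ (for every $\alpha\in\mathbb{C}$) and $E_{11}$ have full row rank. The pencil $\begin{bmatrix} A_{11}-\lambda E_{11}\\ Z_1\end{bmatrix}$ is square and unimodular (invertible over $\mathbb{C}[\lambda]$), and unobservable in this realization. 3. $\begin{bmatrix} A_{33}-\alpha E_{33} & A_{34}-\alpha E_{34}\\ 0 & C_4\end{bmatrix}$ has full column rank for every $\alpha\in\mathbb{C}$, and $C_4$ has full column rank. The subpencil $\begin{bmatrix} A_{33}-\lambda E_{33} & A_{34}-\lambda E_{34}\\ Z_3 & Z_4\end{bmatrix}$ is square and unimodular. -/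

import Mathlib

open scoped Polynomial Matrix

namespace PolySys

noncomputable section

/-- A constant complex matrix, viewed as a polynomial matrix. -/
def const {ι κ : Type*} (M : Matrix ι κ ℂ) : Matrix ι κ ℂ[X] :=
  M.map Polynomial.C

/-- The matrix pencil `A - λ E`. -/
def pencil {ι κ : Type*} (A E : Matrix ι κ ℂ) : Matrix ι κ ℂ[X] :=
  const A - (Polynomial.X : ℂ[X]) • const E

/-- The normal rank of a polynomial matrix: its rank over the field of rational functions. -/
def normalRank {m n : ℕ} (P : Matrix (Fin m) (Fin n) ℂ[X]) : ℕ :=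
  (P.map (algebraMap ℂ[X] (RatFunc ℂ))).rank

/-- A constant matrix is unitary. Rows and columns may carry different labels; the two
identities force the number of rows and of columns to agree. -/
def IsUnitary {ι κ : Type*} [Fintype ι] [Fintype κ] [DecidableEq ι] [DecidableEq κ]
    (Q : Matrix ι κ ℂ) : Prop :=
  Qᴴ * Q = 1 ∧ Q * Qᴴ = 1

/-- A polynomial matrix is unimodular, i.e. square and invertible over `ℂ[λ]`. Rows and columns
may carry different labels; the two identities force their numbers to agree. -/
def IsUnimodular {ι κ : Type*} [Fintype ι] [Fintype κ] [DecidableEq ι] [DecidableEq κ]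
    (M : Matrix ι κ ℂ[X]) : Prop :=
  ∃ N : Matrix κ ι ℂ[X], M * N = 1 ∧ N * M = 1

/-- `s 0, …, s (k-1)` are the invariant polynomials of `M`: they are monic, form a divisibility
chain, and `M = U * diag(s 0, …, s (k-1), 0, …, 0) * V` with unimodular `U`, `V`
(the Smith normal form of `M`). -/
def IsSmithForm {m n k : ℕ} (M : Matrix (Fin m) (Fin n) ℂ[X]) (s : Fin k → ℂ[X]) : Prop :=
  k ≤ m ∧ k ≤ n ∧ (∀ i, (s i).Monic) ∧ (∀ i j, i ≤ j → s i ∣ s j) ∧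
    ∃ (U : Matrix (Fin m) (Fin m) ℂ[X]) (V : Matrix (Fin n) (Fin n) ℂ[X]),
      IsUnimodular U ∧ IsUnimodular V ∧
        M = U * Matrix.of (fun (i : Fin m) (j : Fin n) =>
          if h : i.val < k then (if i.val = j.val then s ⟨i.val, h⟩ else 0) else 0) * V

open Classical in
/-- The multiset of the invariant polynomials different from `1`. -/
def nontrivialPart {k : ℕ} (s : Fin k → ℂ[X]) : Multiset ℂ[X] :=
  (Finset.univ.val.map s).filter (fun p => p ≠ 1)

/-- Two polynomial matrices have the same finite (Smith) zeros, with the same partial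
multiplicities: they have the same invariant polynomials different from `1`. -/
def SameFiniteZeros {m n m' n' : ℕ} (M : Matrix (Fin m) (Fin n) ℂ[X])
    (M' : Matrix (Fin m') (Fin n') ℂ[X]) : Prop :=
  ∃ (k k' : ℕ) (s : Fin k → ℂ[X]) (s' : Fin k' → ℂ[X]),
    IsSmithForm M s ∧ IsSmithForm M' s' ∧ nontrivialPart s = nontrivialPart s'

/-- The first `d` block rows of the state pencil: in block row `i`, the block `I_n` in block
column `i` and the block `-λ I_n` in block column `i + 1`. -/
def shiftRows (d n : ℕ) : Matrix (Fin d × Fin n) (Fin (d + 1) × Fin n) ℂ[X] :=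
  Matrix.of fun i j =>
    if i.2 = j.2 then
      if j.1 = i.1.castSucc then 1 else if j.1 = i.1.succ then -Polynomial.X else 0
    else 0

/-- The last block row `[0 … 0 I_n]` of the state pencil. -/
def lastRow (d n : ℕ) : Matrix (Fin n) (Fin (d + 1) × Fin n) ℂ[X] :=
  Matrix.of fun i j => if j = (Fin.last d, i) then 1 else 0

/-- The block row `[P_d … P_1 P_0]` of the coefficients of `P(λ) = ∑ P_i λ^i`. -/
def coeffRow {m n : ℕ} (d : ℕ) (P : Matrix (Fin m) (Fin n) ℂ[X]) :
    Matrix (Fin m) (Fin (d + 1) × Fin n) ℂ[X] :=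
  Matrix.of fun i j => Polynomial.C ((P i j.2).coeff (Fin.rev j.1))

/-- The generalized state-space system matrix `S_P(λ) = [A - λE, B; C, 0]` of `P(λ)`. -/
def systemMatrix {m n : ℕ} (d : ℕ) (P : Matrix (Fin m) (Fin n) ℂ[X]) :
    Matrix (((Fin d × Fin n) ⊕ Fin n) ⊕ Fin m) ((Fin (d + 1) × Fin n) ⊕ Fin n) ℂ[X] :=
  Matrix.fromBlocks
    (Matrix.fromRows (shiftRows d n) (lastRow d n)) (Matrix.fromRows 0 (-1))
    (coeffRow d P) 0

/-- The system matrix after feedback and unitary transformation,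
`diag(Q*, I_n, I_m) * S_P(λ) * [Z, 0; F Z, I_n]`. -/
def transformed {m n : ℕ} (d : ℕ) (P : Matrix (Fin m) (Fin n) ℂ[X])
    {ι κ : Type*} [Fintype κ]
    (Q : Matrix (Fin d × Fin n) ι ℂ) (Z : Matrix (Fin (d + 1) × Fin n) κ ℂ)
    (F : Matrix (Fin n) (Fin (d + 1) × Fin n) ℂ) :
    Matrix ((ι ⊕ Fin n) ⊕ Fin m) (κ ⊕ Fin n) ℂ[X] :=
  (Matrix.fromBlocks (Matrix.fromBlocks (const Qᴴ) 0 0 1) 0 0 1 :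
      Matrix ((ι ⊕ Fin n) ⊕ Fin m) (((Fin d × Fin n) ⊕ Fin n) ⊕ Fin m) ℂ[X]) *
    systemMatrix d P * Matrix.fromBlocks (const Z) 0 (const (F * Z)) 1

/-- The order-preserving splitting of `n` indices into the first `r` and the last `n - r`. -/
def split {r n : ℕ} (h : r ≤ n) : Fin r ⊕ Fin (n - r) ≃ Fin n :=
  finSumFinEquiv.trans (finCongr (Nat.add_sub_cancel' h))

/-- A block row with four blocks. -/
def row4 {ι κ₁ κ₂ κ₃ κ₄ : Type*} (M₁ : Matrix ι κ₁ ℂ[X]) (M₂ : Matrix ι κ₂ ℂ[X])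
    (M₃ : Matrix ι κ₃ ℂ[X]) (M₄ : Matrix ι κ₄ ℂ[X]) :
    Matrix ι (κ₁ ⊕ κ₂ ⊕ κ₃ ⊕ κ₄) ℂ[X] :=
  Matrix.fromCols M₁ (Matrix.fromCols M₂ (Matrix.fromCols M₃ M₄))

/-- `T` (state pencil) and `K` (output matrix) form the realization. The square subpencil `H` is
unobservable in it: `T` maps the subspace spanned by the columns of a full column rank matrix `R`
into the subspace of the same dimension spanned by the columns of a full column rank matrix `L`,
the restriction of `T` to this deflating pair of subspaces is `H`, and the outputs vanish on it.
In particular `H(α) v = 0` and `v ≠ 0` give a state `x = R v ≠ 0` with `T(α) x = 0`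
and `K(α) x = 0`. -/
def IsUnobservable {ι κ μ α β : Type*} [Fintype κ] [Fintype α] [Fintype β]
    (T : Matrix ι κ ℂ[X]) (K : Matrix μ κ ℂ[X]) (H : Matrix α β ℂ[X]) : Prop :=
  Fintype.card α = Fintype.card β ∧
    ∃ (R : Matrix κ β ℂ) (L : Matrix ι α ℂ),
      R.rank = Fintype.card β ∧ L.rank = Fintype.card α ∧
        T * const R = const L * H ∧ K * const R = 0

end

end PolySys

open PolySys

/-!
The first `d` block rows `M(λ) = A - λ E` of the state pencil have full row rank at every point and
at infinity, and the feedback replaces the last block row by an arbitrary constant matrix. So the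
decomposition only concerns the pencil `M(λ)` and the output matrix `C = [P_d … P_0]`.

Restrict `M(λ)` to `ker C`. Let `V` be the greatest subspace of `ker C` with `A V ≤ E V`, and `W` the
least subspace of `V` that contains `V ⊓ E⁻¹ (A W)`. On `W` both `A - α E` and `E` are onto `E W`
(right Kronecker blocks), between `V / W` and `E V / E W` the map `E` is bijective (finite
eigenvalues), and `A - α E` is injective from `ker C / V` to the quotient by `E V` for every `α`
(`exists_reducing_subspaces`). Orthonormal bases adapted to `W ≤ V ≤ ker C` and to `E W ≤ E V` are the
columns of `Z` and `Q` (`exists_unitary_decomposition`).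

A pencil of full row rank at all points and at infinity is completed to a unimodular matrix by
constant rows (`exists_unimodular_completion`); this provides `Z₁` and `[Z₃ Z₄]`. The block
`[A₁₁ - λ E₁₁; Z₁]` has no finite eigenvalues and `A₂₂ - λ E₂₂` has only finite ones, so a generalized
Sylvester equation (`exists_sylvester`) decouples the two, and the second is unobservable.

For the zeros, `[M; C]` is unimodularly equivalent to `diag(I, P)`, because the state pencil has a
polynomial inverse whose last block column is `[λ^d I; …; I]`
(`unimodEquiv_shiftRows_coeffRow`). The block triangular form makes it equivalent to
`diag([I 0], A₂₂ - λ E₂₂, [I; 0])`. Existence and uniqueness of the Smith form (`exists_smithMatrix`,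
`IsInvariantChain.unique`) then give the invariant polynomials, and counting them gives the numbers
`n - r` and `r` of the rows of `Z₁` and `[Z₃ Z₄]` (`finiteZeros_of_decomposition`).
-/

namespace PolySys

/-! ### Constant matrices, pencils, and unimodular equivalence -/

section Const

variable {ι κ μ : Type*}

theorem const_apply (M : Matrix ι κ ℂ) (i : ι) (j : κ) : const M i j = Polynomial.C (M i j) := rfl

@[simp]
theorem const_zero : const (0 : Matrix ι κ ℂ) = 0 := by
  ext1 i j; simp [const_apply]

@[simp]
theorem const_one [DecidableEq ι] : const (1 : Matrix ι ι ℂ) = 1 := by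
  simp [const]

theorem const_mul [Fintype κ] (M : Matrix ι κ ℂ) (N : Matrix κ μ ℂ) :
    const (M * N) = const M * const N := by
  simp [const, Matrix.map_mul]

theorem const_sub (M N : Matrix ι κ ℂ) : const (M - N) = const M - const N := by
  ext1 i j; simp [const_apply]

theorem const_fromCols {κ' : Type*} (M : Matrix ι κ ℂ) (N : Matrix ι κ' ℂ) :
    const (Matrix.fromCols M N) = Matrix.fromCols (const M) (const N) :=
  Matrix.fromCols_map ..

theorem pencil_apply (A E : Matrix ι κ ℂ) (i : ι) (j : κ) :
    pencil A E i j = Polynomial.C (A i j) - Polynomial.X * Polynomial.C (E i j) := by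
  simp [pencil, const_apply]

@[simp]
theorem pencil_zero_right (A : Matrix ι κ ℂ) : pencil A 0 = const A := by
  simp [pencil]

theorem pencil_mul_const [Fintype κ] (A E : Matrix ι κ ℂ) (N : Matrix κ μ ℂ) :
    pencil A E * const N = pencil (A * N) (E * N) := by
  simp [pencil, const_mul, Matrix.sub_mul]

theorem const_mul_pencil [Fintype κ] (N : Matrix ι κ ℂ) (A E : Matrix κ μ ℂ) :
    const N * pencil A E = pencil (N * A) (N * E) := by
  simp [pencil, const_mul, Matrix.mul_sub]

theorem pencil_fromRows {ι' : Type*} (A E : Matrix ι κ ℂ) (A' E' : Matrix ι' κ ℂ) :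
    pencil (Matrix.fromRows A A') (Matrix.fromRows E E') =
      Matrix.fromRows (pencil A E) (pencil A' E') := by
  ext1 i j; cases i <;> simp [pencil_apply]

theorem pencil_map_eval (A E : Matrix ι κ ℂ) (α : ℂ) :
    (pencil A E).map (Polynomial.eval α) = A - α • E := by
  ext i j; simp [pencil_apply]; ring

end Const

section Unimodular

variable {ι κ μ ι' κ' μ' : Type*} [Fintype ι] [Fintype κ] [Fintype μ] [Fintype ι'] [Fintype κ']
  [Fintype μ'] [DecidableEq ι] [DecidableEq κ] [DecidableEq μ] [DecidableEq ι'] [DecidableEq κ']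
  [DecidableEq μ']

theorem IsUnimodular.one : IsUnimodular (1 : Matrix ι ι ℂ[X]) := ⟨1, by simp, by simp⟩

theorem IsUnimodular.mul {M : Matrix ι κ ℂ[X]} {N : Matrix κ μ ℂ[X]} (hM : IsUnimodular M)
    (hN : IsUnimodular N) : IsUnimodular (M * N) := by
  obtain ⟨M', h1, h2⟩ := hM
  obtain ⟨N', h3, h4⟩ := hN
  refine ⟨N' * M', ?_, ?_⟩
  · rw [Matrix.mul_assoc, ← Matrix.mul_assoc N, h3, Matrix.one_mul, h1]
  · rw [Matrix.mul_assoc, ← Matrix.mul_assoc M', h2, Matrix.one_mul, h4]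

theorem IsUnimodular.card_eq {M : Matrix ι κ ℂ[X]} (hM : IsUnimodular M) :
    Fintype.card ι = Fintype.card κ := by
  obtain ⟨N, h1, h2⟩ := hM
  exact Matrix.square_of_invertible M N h1 h2

theorem IsUnimodular.submatrix {M : Matrix ι κ ℂ[X]} (hM : IsUnimodular M) (e : ι' ≃ ι)
    (f : κ' ≃ κ) : IsUnimodular (M.submatrix e f) := by
  obtain ⟨N, h1, h2⟩ := hM
  refine ⟨N.submatrix f e, ?_, ?_⟩
  · rw [Matrix.submatrix_mul_equiv, h1, Matrix.submatrix_one_equiv]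
  · rw [Matrix.submatrix_mul_equiv, h2, Matrix.submatrix_one_equiv]

theorem IsUnimodular.const {M : Matrix ι κ ℂ} {N : Matrix κ ι ℂ} (h1 : M * N = 1)
    (h2 : N * M = 1) : IsUnimodular (const M) :=
  ⟨PolySys.const N, by rw [← const_mul, h1, const_one], by rw [← const_mul, h2, const_one]⟩

theorem IsUnimodular.fromBlocks_upper {A : Matrix ι κ ℂ[X]} {D : Matrix ι' κ' ℂ[X]}
    (hA : IsUnimodular A) (B : Matrix ι κ' ℂ[X]) (hD : IsUnimodular D) :
    IsUnimodular (Matrix.fromBlocks A B 0 D) := by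
  obtain ⟨A', h1, h2⟩ := hA
  obtain ⟨D', h3, h4⟩ := hD
  refine ⟨Matrix.fromBlocks A' (-(A' * B * D')) 0 D', ?_, ?_⟩
  · rw [Matrix.fromBlocks_multiply, ← Matrix.fromBlocks_one]
    congr 1
    · simp [h1]
    · rw [Matrix.mul_neg, ← Matrix.mul_assoc, ← Matrix.mul_assoc, h1]; simp
    · simp
    · simp [h3]
  · rw [Matrix.fromBlocks_multiply, ← Matrix.fromBlocks_one]
    congr 1
    · simp [h2]
    · rw [Matrix.neg_mul, Matrix.mul_assoc _ D', h4]; simp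
    · simp
    · simp [h4]

theorem IsUnimodular.fromBlocks_lower {A : Matrix ι κ ℂ[X]} {D : Matrix ι' κ' ℂ[X]}
    (hA : IsUnimodular A) (C : Matrix ι' κ ℂ[X]) (hD : IsUnimodular D) :
    IsUnimodular (Matrix.fromBlocks A 0 C D) := by
  have := (hD.fromBlocks_upper C hA).submatrix (Equiv.sumComm ι ι') (Equiv.sumComm κ κ')
  convert this using 1
  ext i j
  cases i <;> cases j <;> rfl

/-- Unimodular equivalence of polynomial matrices. The index types on the two sides may differ, so
that relabelling of rows and columns is included. -/
def UnimodEquiv (M : Matrix ι κ ℂ[X]) (N : Matrix ι' κ' ℂ[X]) : Prop :=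
  ∃ (U : Matrix ι' ι ℂ[X]) (V : Matrix κ κ' ℂ[X]),
    IsUnimodular U ∧ IsUnimodular V ∧ U * M * V = N

theorem UnimodEquiv.refl (M : Matrix ι κ ℂ[X]) : UnimodEquiv M M :=
  ⟨1, 1, .one, .one, by simp⟩

theorem UnimodEquiv.trans {M : Matrix ι κ ℂ[X]} {N : Matrix ι' κ' ℂ[X]} {O : Matrix μ μ' ℂ[X]}
    (h : UnimodEquiv M N) (h' : UnimodEquiv N O) : UnimodEquiv M O := by
  obtain ⟨U, V, hU, hV, rfl⟩ := h
  obtain ⟨U', V', hU', hV', rfl⟩ := h'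
  exact ⟨U' * U, V * V', hU'.mul hU, hV.mul hV', by simp only [Matrix.mul_assoc]⟩

theorem UnimodEquiv.symm {M : Matrix ι κ ℂ[X]} {N : Matrix ι' κ' ℂ[X]}
    (h : UnimodEquiv M N) : UnimodEquiv N M := by
  obtain ⟨U, V, ⟨U', h1, h2⟩, ⟨V', h3, h4⟩, rfl⟩ := h
  refine ⟨U', V', ⟨U, h2, h1⟩, ⟨V, h4, h3⟩, ?_⟩
  rw [Matrix.mul_assoc, Matrix.mul_assoc, h3, Matrix.mul_one, ← Matrix.mul_assoc, h2,
    Matrix.one_mul]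

theorem UnimodEquiv.mul_left {U : Matrix ι' ι ℂ[X]} (hU : IsUnimodular U) (M : Matrix ι κ ℂ[X]) :
    UnimodEquiv M (U * M) := ⟨U, 1, hU, .one, by simp⟩

theorem UnimodEquiv.mul_right {V : Matrix κ κ' ℂ[X]} (M : Matrix ι κ ℂ[X]) (hV : IsUnimodular V) :
    UnimodEquiv M (M * V) := ⟨1, V, .one, hV, by simp⟩

theorem UnimodEquiv.submatrix (M : Matrix ι κ ℂ[X]) (e : ι' ≃ ι) (f : κ' ≃ κ) :
    UnimodEquiv M (M.submatrix e f) :=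
  ⟨(1 : Matrix ι ι ℂ[X]).submatrix e (Equiv.refl ι), (1 : Matrix κ κ ℂ[X]).submatrix (Equiv.refl κ) f,
    IsUnimodular.one.submatrix _ _, IsUnimodular.one.submatrix _ _, by
    conv_lhs => enter [1, 2]; rw [← M.submatrix_id_id]
    rw [← Equiv.coe_refl, ← Equiv.coe_refl, Matrix.submatrix_mul_equiv, Matrix.submatrix_mul_equiv]
    simp⟩

theorem UnimodEquiv.fromBlocks {M : Matrix ι κ ℂ[X]} {N : Matrix ι' κ' ℂ[X]}
    {ι₂ κ₂ ι₂' κ₂' : Type*} [Fintype ι₂] [Fintype κ₂] [Fintype ι₂'] [Fintype κ₂']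
    [DecidableEq ι₂] [DecidableEq κ₂] [DecidableEq ι₂'] [DecidableEq κ₂']
    {M₂ : Matrix ι₂ κ₂ ℂ[X]} {N₂ : Matrix ι₂' κ₂' ℂ[X]}
    (h : UnimodEquiv M N) (h₂ : UnimodEquiv M₂ N₂) :
    UnimodEquiv (Matrix.fromBlocks M 0 0 M₂) (Matrix.fromBlocks N 0 0 N₂) := by
  obtain ⟨U, V, hU, hV, rfl⟩ := h
  obtain ⟨U', V', hU', hV', rfl⟩ := h₂
  exact ⟨Matrix.fromBlocks U 0 0 U', Matrix.fromBlocks V 0 0 V', hU.fromBlocks_upper 0 hU',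
    hV.fromBlocks_upper 0 hV', by simp [Matrix.fromBlocks_multiply]⟩

/-- Column operations clear the block to the right of a right invertible block. -/
theorem UnimodEquiv.clear_right {M : Matrix ι κ ℂ[X]} {M' : Matrix κ ι ℂ[X]} (h : M * M' = 1)
    (B : Matrix ι κ' ℂ[X]) (D : Matrix ι' κ' ℂ[X]) :
    UnimodEquiv (Matrix.fromBlocks M B 0 D) (Matrix.fromBlocks M 0 0 D) := by
  refine ⟨1, Matrix.fromBlocks 1 (-(M' * B)) 0 1, .one,
    IsUnimodular.one.fromBlocks_upper _ .one, ?_⟩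
  rw [Matrix.one_mul, Matrix.fromBlocks_multiply]
  simp [← Matrix.mul_assoc, h]

/-- Row operations clear the block above a left invertible block. -/
theorem UnimodEquiv.clear_above {D : Matrix ι' κ' ℂ[X]} {D' : Matrix κ' ι' ℂ[X]} (h : D' * D = 1)
    (M : Matrix ι κ ℂ[X]) (B : Matrix ι κ' ℂ[X]) :
    UnimodEquiv (Matrix.fromBlocks M B 0 D) (Matrix.fromBlocks M 0 0 D) := by
  refine ⟨Matrix.fromBlocks 1 (-(B * D')) 0 1, 1,
    IsUnimodular.one.fromBlocks_upper _ .one, .one, ?_⟩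
  rw [Matrix.mul_one, Matrix.fromBlocks_multiply]
  simp [Matrix.mul_assoc, h]

end Unimodular

/-! ### The Smith form: existence and uniqueness -/

section Smith

/-- The matrix `diag(s 0, …, s (k-1))`, bordered by zero rows indexed by `a` and zero columns
indexed by `b`. -/
noncomputable def smithMatrix {k : ℕ} (s : Fin k → ℂ[X]) (a b : Type*) :
    Matrix (Fin k ⊕ a) (Fin k ⊕ b) ℂ[X] :=
  Matrix.fromBlocks (Matrix.diagonal s) 0 0 0

/-- A chain of invariant polynomials: monic polynomials, each dividing the following ones. -/
def IsInvariantChain {k : ℕ} (s : Fin k → ℂ[X]) : Prop :=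
  (∀ i, (s i).Monic) ∧ ∀ i j, i ≤ j → s i ∣ s j

theorem UnimodEquiv.dvd_of_dvd {ι κ ι' κ' : Type*} [Fintype ι] [Fintype κ] [Fintype ι']
    [Fintype κ'] [DecidableEq ι] [DecidableEq κ] [DecidableEq ι'] [DecidableEq κ']
    {M : Matrix ι κ ℂ[X]} {N : Matrix ι' κ' ℂ[X]} (h : UnimodEquiv M N) {g : ℂ[X]}
    (hg : ∀ i j, g ∣ M i j) (i : ι') (j : κ') : g ∣ N i j := by
  obtain ⟨U, V, -, -, rfl⟩ := h
  simp only [Matrix.mul_apply]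
  exact Finset.dvd_sum fun k _ => Dvd.dvd.mul_right
    (Finset.dvd_sum fun l _ => Dvd.dvd.mul_left (hg _ _) _) _

/-- An entry of least degree among all nonzero entries of all equivalent matrices can be split off
as a diagonal block which divides all other entries. -/
theorem exists_unimodEquiv_split {a b : ℕ} (M : Matrix (Fin (a + 1)) (Fin (b + 1)) ℂ[X])
    (hM : M ≠ 0) :
    ∃ (g : ℂ[X]) (B : Matrix (Fin a) (Fin b) ℂ[X]), g.Monic ∧ (∀ i j, g ∣ B i j) ∧
      UnimodEquiv M (Matrix.fromBlocks (Matrix.of fun _ _ : Unit => g) 0 0 B) := by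
  classical
  let e (k : ℕ) : Unit ⊕ Fin k ≃ Fin (k + 1) := Fintype.equivOfCardEq (by simp; omega)
  let S : Set ℕ := {t | ∃ N : Matrix (Unit ⊕ Fin a) (Unit ⊕ Fin b) ℂ[X], UnimodEquiv M N ∧
    ∃ i j, N i j ≠ 0 ∧ (N i j).natDegree = t}
  have hS : ∃ t, t ∈ S := by
    obtain ⟨i, j, hij⟩ : ∃ i j, M i j ≠ 0 := by
      by_contra! h
      exact hM (by ext1 i j; exact h i j)
    exact ⟨_, M.submatrix (e a) (e b), .submatrix M _ _, (e a).symm i, (e b).symm j, by simpa, rfl⟩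
  obtain ⟨N, hMN, i₀, j₀, hij, hdeg⟩ := Nat.find_spec hS
  have hmin : ∀ N' : Matrix (Unit ⊕ Fin a) (Unit ⊕ Fin b) ℂ[X], UnimodEquiv M N' →
      ∀ i j, (N' i j).natDegree < (N i₀ j₀).natDegree → N' i j = 0 := by
    intro N' hN' i j hlt
    by_contra h0
    rw [hdeg] at hlt
    exact Nat.find_min hS hlt ⟨N', hN', i, j, h0, rfl⟩
  -- move the entry of least degree to the corner and make it monic
  set g : ℂ[X] := Polynomial.C (N i₀ j₀).leadingCoeff⁻¹ * N i₀ j₀ with hg_def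
  have hlc : (N i₀ j₀).leadingCoeff ≠ 0 := by simpa using hij
  have hg : g.Monic := by
    rw [hg_def, mul_comm]; exact Polynomial.monic_mul_leadingCoeff_inv hij
  have hgdeg : g.natDegree = (N i₀ j₀).natDegree :=
    Polynomial.natDegree_C_mul (inv_ne_zero hlc)
  rw [← hgdeg] at hmin
  have hscale : IsUnimodular (const (Matrix.fromBlocks
      (Matrix.of fun _ _ : Unit => (N i₀ j₀).leadingCoeff⁻¹) 0 0 (1 : Matrix (Fin a) (Fin a) ℂ))) := by
    refine IsUnimodular.const (N := Matrix.fromBlocks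
      (Matrix.of fun _ _ : Unit => (N i₀ j₀).leadingCoeff) 0 0 1) ?_ ?_ <;>
    · rw [Matrix.fromBlocks_multiply, ← Matrix.fromBlocks_one]
      congr 1 <;> ext i j <;> simp [Matrix.mul_apply, hlc]
  obtain ⟨N₁, hN₁, hcorner⟩ : ∃ N₁ : Matrix (Unit ⊕ Fin a) (Unit ⊕ Fin b) ℂ[X],
      UnimodEquiv M N₁ ∧ N₁ (Sum.inl ()) (Sum.inl ()) = g := by
    refine ⟨_, (hMN.trans (.submatrix N (Equiv.swap (Sum.inl ()) i₀)
      (Equiv.swap (Sum.inl ()) j₀))).trans (.mul_left hscale _), ?_⟩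
    simp [Matrix.mul_apply, const_apply, hg_def]
  obtain ⟨R, C, D, rfl⟩ : ∃ R C D, N₁ = Matrix.fromBlocks (Matrix.of fun _ _ : Unit => g) R C D :=
    ⟨N₁.toBlocks₁₂, N₁.toBlocks₂₁, N₁.toBlocks₂₂, by
      conv_lhs => rw [← Matrix.fromBlocks_toBlocks N₁]
      congr 1
      ext1 i j
      exact hcorner⟩
  have hmod : ∀ p : ℂ[X], p %ₘ g ≠ 0 → (p %ₘ g).natDegree < g.natDegree := by
    intro p hp
    refine Polynomial.natDegree_modByMonic_lt p hg fun h1 => hp ?_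
    rw [h1, Polynomial.modByMonic_one]
  have hdvd : ∀ (N' : Matrix (Unit ⊕ Fin a) (Unit ⊕ Fin b) ℂ[X]), UnimodEquiv M N' →
      ∀ i j p, N' i j = p %ₘ g → g ∣ p := by
    intro N' hN' i j p hp
    rw [← Polynomial.modByMonic_eq_zero_iff_dvd hg]
    by_contra h0
    exact h0 (hp ▸ hmin N' hN' i j (hp ▸ hmod p h0))
  have key : ∀ p : ℂ[X], p - g * (p /ₘ g) = p %ₘ g := fun p =>
    (Polynomial.modByMonic_eq_sub_mul_div p g).symm
  have hC : ∀ i j, g ∣ C i j := by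
    intro i j
    have hU : IsUnimodular (Matrix.fromBlocks 1 0 (-(C.map (· /ₘ g))) 1 :
      Matrix (Unit ⊕ Fin a) (Unit ⊕ Fin a) ℂ[X]) := IsUnimodular.one.fromBlocks_lower _ .one
    refine hdvd _ (hN₁.trans (.mul_left hU _)) (Sum.inr i) (Sum.inl j) _ ?_
    rw [Matrix.fromBlocks_multiply, ← key]
    simp [Matrix.mul_apply]
    ring
  have hR : ∀ i j, g ∣ R i j := by
    intro i j
    have hV : IsUnimodular (Matrix.fromBlocks 1 (-(R.map (· /ₘ g))) 0 1 :
      Matrix (Unit ⊕ Fin b) (Unit ⊕ Fin b) ℂ[X]) := IsUnimodular.one.fromBlocks_upper _ .one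
    refine hdvd _ (hN₁.trans (.mul_right _ hV)) (Sum.inl i) (Sum.inr j) _ ?_
    rw [Matrix.fromBlocks_multiply, ← key]
    simp [Matrix.mul_apply]
    ring
  choose C' hC' using hC
  choose R' hR' using hR
  set B : Matrix (Fin a) (Fin b) ℂ[X] := D - Matrix.of C' * R with hB
  have hM2 : UnimodEquiv M (Matrix.fromBlocks (Matrix.of fun _ _ : Unit => g) 0 0 B) := by
    have hU : IsUnimodular (Matrix.fromBlocks 1 0 (-(Matrix.of C')) 1 :
      Matrix (Unit ⊕ Fin a) (Unit ⊕ Fin a) ℂ[X]) := IsUnimodular.one.fromBlocks_lower _ .one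
    have hV : IsUnimodular (Matrix.fromBlocks 1 (-(Matrix.of R')) 0 1 :
      Matrix (Unit ⊕ Fin b) (Unit ⊕ Fin b) ℂ[X]) := IsUnimodular.one.fromBlocks_upper _ .one
    convert hN₁.trans ⟨_, _, hU, hV, rfl⟩ using 1
    symm
    simp only [Matrix.fromBlocks_multiply]
    congr 1
    · simp
    · ext1 i j; simp [Matrix.mul_apply, hR']
    · ext1 i j; simp [Matrix.mul_apply, hC', mul_comm]
    · ext1 i j
      simp [Matrix.mul_apply, hB, hC']
      ring
  refine ⟨g, B, hg, fun i j => ?_, hM2⟩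
  -- adding row `i` of `B` to the first row brings `B i j` next to the corner
  have hU : IsUnimodular (Matrix.fromBlocks 1 (Matrix.of fun _ k => if k = i then 1 else 0) 0 1 :
    Matrix (Unit ⊕ Fin a) (Unit ⊕ Fin a) ℂ[X]) := IsUnimodular.one.fromBlocks_upper _ .one
  have hV : IsUnimodular (Matrix.fromBlocks 1 (-(Matrix.of fun _ k => B i k /ₘ g)) 0 1 :
    Matrix (Unit ⊕ Fin b) (Unit ⊕ Fin b) ℂ[X]) := IsUnimodular.one.fromBlocks_upper _ .one
  refine hdvd _ (hM2.trans ⟨_, _, hU, hV, rfl⟩) (Sum.inl ()) (Sum.inr j) _ ?_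
  rw [Matrix.fromBlocks_multiply, Matrix.fromBlocks_multiply, ← key]
  simp [Matrix.mul_apply]
  ring

theorem exists_smithMatrix {m n : ℕ} (M : Matrix (Fin m) (Fin n) ℂ[X]) :
    ∃ (k a b : ℕ) (s : Fin k → ℂ[X]), IsInvariantChain s ∧
      UnimodEquiv M (smithMatrix s (Fin a) (Fin b)) := by
  induction m generalizing n with
  | zero =>
    refine ⟨0, 0, n, Fin.elim0, ⟨fun i => i.elim0, fun i => i.elim0⟩, ?_⟩
    convert UnimodEquiv.submatrix M (Equiv.emptySum (Fin 0) (Fin 0)) (Equiv.emptySum (Fin 0) (Fin n))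
      using 1
    ext1 i j
    rcases i with i | i <;> exact i.elim0
  | succ m ih =>
    by_cases hM : M = 0
    · subst hM
      refine ⟨0, m + 1, n, Fin.elim0, ⟨fun i => i.elim0, fun i => i.elim0⟩, ?_⟩
      convert UnimodEquiv.submatrix 0 (Equiv.emptySum (Fin 0) (Fin (m + 1)))
        (Equiv.emptySum (Fin 0) (Fin n)) using 1
      ext1 i j
      rcases i with i | i
      · exact i.elim0
      · rcases j with j | j
        · exact j.elim0
        · rfl
    · obtain _ | n := n
      · exact absurd (by ext1 i j; exact j.elim0) hM
      obtain ⟨g, B, hg, hB, hMB⟩ := exists_unimodEquiv_split M hM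
      obtain ⟨k, a, b, s, hs, hBs⟩ := ih B
      have hgs : ∀ i, g ∣ s i := fun i => by
        simpa [smithMatrix] using hBs.dvd_of_dvd hB (Sum.inl i) (Sum.inl i)
      refine ⟨k + 1, a, b, Fin.cons g s, ⟨?_, ?_⟩, ?_⟩
      · exact fun i => Fin.cases hg hs.1 i
      · intro i j
        refine Fin.cases (fun _ => Fin.cases (by simp) (fun j => by simpa using hgs j) j)
          (fun i => Fin.cases (fun h => absurd h (by simp)) (fun j h => ?_) j) i
        simpa using hs.2 i j (by simpa using h)
      · refine (hMB.trans (UnimodEquiv.fromBlocks (.refl _) hBs)).trans ?_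
        let e : Fin (k + 1) ≃ Unit ⊕ Fin k :=
          (finSuccEquiv k).trans ((Equiv.optionEquivSumPUnit _).trans (Equiv.sumComm _ _))
        let f (c : ℕ) : Fin (k + 1) ⊕ Fin c ≃ Unit ⊕ (Fin k ⊕ Fin c) :=
          (Equiv.sumCongr e (Equiv.refl _)).trans (Equiv.sumAssoc _ _ _)
        have he0 : e 0 = Sum.inl () := by simp [e]
        have hes : ∀ i : Fin k, e i.succ = Sum.inr i := fun i => by simp [e]
        convert UnimodEquiv.submatrix _ (f a) (f b) using 1
        ext1 i j
        rcases i with i | i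
        · rcases j with j | j
          · refine Fin.cases ?_ (fun i => ?_) i <;> refine Fin.cases ?_ (fun j => ?_) j <;>
              simp [f, he0, hes, smithMatrix, Matrix.diagonal_apply, Fin.succ_ne_zero,
                (Fin.succ_ne_zero _).symm]
          · refine Fin.cases ?_ (fun i => ?_) i <;> simp [f, he0, hes, smithMatrix]
        · rcases j with j | j
          · refine Fin.cases ?_ (fun j => ?_) j <;> simp [f, he0, hes, smithMatrix]
          · simp [f, smithMatrix]

/-- In a divisibility chain, the product of the first `j` terms divides the product of any `j`
distinct terms. -/
theorem IsInvariantChain.prod_dvd {k : ℕ} {s : Fin k → ℂ[X]} (hs : IsInvariantChain s) {j : ℕ}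
    (hj : j ≤ k) {f : Fin j → Fin k} (hf : Function.Injective f) :
    ∏ i, s (Fin.castLE hj i) ∣ ∏ i, s (f i) := by
  classical
  set F := Finset.univ.image f with hF
  have hcard : F.card = j := by simp [hF, Finset.card_image_of_injective _ hf]
  have h1 : ∏ i, s (f i) = ∏ x ∈ F, s x := by
    rw [hF, Finset.prod_image fun a _ b _ h => hf h]
  have h2 : ∏ x ∈ F, s x = ∏ i, s (F.orderEmbOfFin hcard i) := by
    rw [← Finset.prod_image (s := Finset.univ) (g := F.orderEmbOfFin hcard)
      (f := s) (fun a _ b _ h => (F.orderEmbOfFin hcard).injective h)]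
    congr 1
    ext x
    simp only [Finset.mem_image, Finset.mem_univ, true_and]
    rw [← Finset.mem_coe, ← Finset.range_orderEmbOfFin F hcard]
    rfl
  rw [h1, h2]
  refine Finset.prod_dvd_prod_of_dvd _ _ fun i _ => hs.2 _ _ ?_
  have hle : ∀ (l : ℕ) (hl : l < j), l ≤ (F.orderEmbOfFin hcard ⟨l, hl⟩).val := by
    intro l
    induction l with
    | zero => exact fun _ => Nat.zero_le _
    | succ l ih =>
      intro hl
      refine (ih (by omega)).trans_lt ?_
      exact (F.orderEmbOfFin hcard).strictMono (by simp [Fin.lt_def])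
  exact hle i i.isLt

/-- The minors of order `j` of a matrix that factors through `diag(s 0, …, s (k-1))` are multiples
of `s 0 ⋯ s (j-1)`, and vanish for `j > k`. -/
theorem prod_dvd_det {k : ℕ} {s : Fin k → ℂ[X]} (hs : IsInvariantChain s) {j : ℕ}
    (A : Matrix (Fin j) (Fin k) ℂ[X]) (B : Matrix (Fin k) (Fin j) ℂ[X]) :
    (k < j → (A * Matrix.diagonal s * B).det = 0) ∧
      ∀ hj : j ≤ k, ∏ i, s (Fin.castLE hj i) ∣ (A * Matrix.diagonal s * B).det := by
  classical
  have hdet : (A * Matrix.diagonal s * B).det =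
      ∑ f : Fin j → Fin k, (∏ i, A i (f i) * s (f i)) * (B.submatrix f id).det := by
    have : A * Matrix.diagonal s * B =
        Matrix.of fun i => ∑ l : Fin k, (A i l * s l) • B l := by
      ext1 i l
      simp [Matrix.mul_apply (M := A * Matrix.diagonal s), Matrix.mul_diagonal, Finset.sum_apply]
    rw [this]
    refine (Matrix.detRowAlternating.toMultilinearMap.map_sum
      (fun i l => (A i l * s l) • B l)).trans (Finset.sum_congr rfl fun f _ => ?_)
    exact Matrix.detRowAlternating.toMultilinearMap.map_smul_univ
      (fun i => A i (f i) * s (f i)) (fun i => B (f i))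
  have hninj : ∀ f : Fin j → Fin k, ¬ Function.Injective f → (B.submatrix f id).det = 0 := by
    intro f hf
    simp only [Function.Injective, not_forall] at hf
    obtain ⟨a, b, hab, hne⟩ := hf
    exact Matrix.det_zero_of_row_eq hne (by ext1 l; simp [hab])
  rw [hdet]
  refine ⟨fun hlt => Finset.sum_eq_zero fun f _ => ?_, fun hj => Finset.dvd_sum fun f _ => ?_⟩
  · rw [hninj f, mul_zero]
    intro hf
    have := Fintype.card_le_of_injective f hf
    simp at this
    omega
  · by_cases hf : Function.Injective f
    · rw [Finset.prod_mul_distrib]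
      exact ((hs.prod_dvd hj hf).mul_left _).mul_right _
    · rw [hninj f hf, mul_zero]
      exact dvd_zero _

theorem smithMatrix_eq {k : ℕ} (s : Fin k → ℂ[X]) (a b : Type*) :
    smithMatrix s a b = (Matrix.fromRows 1 0 : Matrix (Fin k ⊕ a) (Fin k) ℂ[X]) *
      Matrix.diagonal s * (Matrix.fromCols 1 0 : Matrix (Fin k) (Fin k ⊕ b) ℂ[X]) := by
  rw [Matrix.fromRows_mul, Matrix.fromRows_mul_fromCols]
  simp [smithMatrix]

theorem diagonal_eq_smithMatrix {k : ℕ} (s : Fin k → ℂ[X]) (a b : Type*) [Fintype a]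
    [Fintype b] :
    Matrix.diagonal s = (Matrix.fromCols 1 0 : Matrix (Fin k) (Fin k ⊕ a) ℂ[X]) *
      smithMatrix s a b * (Matrix.fromRows 1 0 : Matrix (Fin k ⊕ b) (Fin k) ℂ[X]) := by
  rw [smithMatrix, Matrix.fromCols_mul_fromBlocks, Matrix.fromCols_mul_fromRows]
  simp

theorem IsInvariantChain.dvd_of_unimodEquiv {k k' : ℕ} {a b a' b' : Type*} [Fintype a] [Fintype b]
    [Fintype a'] [Fintype b'] [DecidableEq a] [DecidableEq b] [DecidableEq a'] [DecidableEq b']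
    {s : Fin k → ℂ[X]}
    {s' : Fin k' → ℂ[X]} (hs : IsInvariantChain s) (hs' : IsInvariantChain s')
    (h : UnimodEquiv (smithMatrix s a b) (smithMatrix s' a' b')) :
    k' ≤ k ∧ ∀ (j : ℕ) (hj : j ≤ k) (hj' : j ≤ k'),
      ∏ i, s (Fin.castLE hj i) ∣ ∏ i, s' (Fin.castLE hj' i) := by
  obtain ⟨U, V, -, -, hUV⟩ := h
  have hfac : ∀ (j : ℕ) (hj' : j ≤ k'), ∃ (A : Matrix (Fin j) (Fin k) ℂ[X])
      (B : Matrix (Fin k) (Fin j) ℂ[X]),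
      ∏ i, s' (Fin.castLE hj' i) = (A * Matrix.diagonal s * B).det := by
    intro j hj'
    let A₀ : Matrix (Fin k') (Fin k) ℂ[X] :=
      (Matrix.fromCols 1 0 : Matrix (Fin k') (Fin k' ⊕ a') ℂ[X]) * U *
        (Matrix.fromRows 1 0 : Matrix (Fin k ⊕ a) (Fin k) ℂ[X])
    let B₀ : Matrix (Fin k) (Fin k') ℂ[X] :=
      (Matrix.fromCols 1 0 : Matrix (Fin k) (Fin k ⊕ b) ℂ[X]) * V *
        (Matrix.fromRows 1 0 : Matrix (Fin k' ⊕ b') (Fin k') ℂ[X])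
    refine ⟨A₀.submatrix (Fin.castLE hj') id, B₀.submatrix id (Fin.castLE hj'), ?_⟩
    have : Matrix.diagonal s' = A₀ * Matrix.diagonal s * B₀ := by
      rw [diagonal_eq_smithMatrix s' a' b', ← hUV, smithMatrix_eq s]
      simp only [A₀, B₀, Matrix.mul_assoc]
    rw [← Matrix.submatrix_id_id (Matrix.diagonal s), ← Matrix.submatrix_mul _ _ _ _ _
      Function.bijective_id, ← Matrix.submatrix_mul _ _ _ _ _ Function.bijective_id]
    rw [← this, Matrix.submatrix_diagonal _ _ (Fin.castLE_injective hj'), Matrix.det_diagonal]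
    rfl
  refine ⟨?_, fun j hj hj' => ?_⟩
  · by_contra! hlt
    obtain ⟨A, B, hAB⟩ := hfac k' le_rfl
    rw [(prod_dvd_det hs A B).1 hlt] at hAB
    exact (Polynomial.monic_prod_of_monic _ _ fun i _ => hs'.1 _).ne_zero hAB
  · obtain ⟨A, B, hAB⟩ := hfac j hj'
    rw [hAB]
    exact (prod_dvd_det hs A B).2 hj

/-- Uniqueness of the Smith form. -/
theorem IsInvariantChain.unique {k k' : ℕ} {a b a' b' : Type*} [Fintype a] [Fintype b]
    [Fintype a'] [Fintype b'] [DecidableEq a] [DecidableEq b] [DecidableEq a'] [DecidableEq b']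
    {s : Fin k → ℂ[X]}
    {s' : Fin k' → ℂ[X]} (hs : IsInvariantChain s) (hs' : IsInvariantChain s')
    (h : UnimodEquiv (smithMatrix s a b) (smithMatrix s' a' b')) :
    ∃ hk : k' = k, ∀ i, s' i = s (Fin.cast hk i) := by
  obtain ⟨h1, h2⟩ := hs.dvd_of_unimodEquiv hs' h
  obtain ⟨h3, h4⟩ := hs'.dvd_of_unimodEquiv hs h.symm
  obtain rfl : k' = k := le_antisymm h1 h3
  have hprod : ∀ (j : ℕ) (hj : j ≤ k'),
      ∏ i, s (Fin.castLE hj i) = ∏ i, s' (Fin.castLE hj i) := fun j hj =>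
    Polynomial.eq_of_monic_of_associated (Polynomial.monic_prod_of_monic _ _ fun i _ => hs.1 _)
      (Polynomial.monic_prod_of_monic _ _ fun i _ => hs'.1 _)
      (associated_of_dvd_dvd (h2 j hj hj) (h4 j hj hj))
  refine ⟨rfl, fun i => ?_⟩
  have h5 := hprod (i + 1) i.isLt
  rw [Fin.prod_univ_castSucc, Fin.prod_univ_castSucc] at h5
  have h6 := hprod i i.isLt.le
  simp only [Fin.castLE_castSucc] at h5
  rw [h6] at h5
  exact (mul_left_cancel₀
    (Polynomial.monic_prod_of_monic _ _ fun i _ => hs'.1 _).ne_zero h5).symm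

end Smith

/-! ### Consequences of the Smith form -/

section SmithConsequences

variable {ι κ ι' κ' : Type*} [Fintype ι] [Fintype κ] [Fintype ι'] [Fintype κ']
  [DecidableEq ι] [DecidableEq κ] [DecidableEq ι'] [DecidableEq κ']

theorem isSmithForm_of_unimodEquiv {m n k : ℕ} {a b : Type*} [Fintype a] [Fintype b]
    [DecidableEq a] [DecidableEq b] {M : Matrix (Fin m) (Fin n) ℂ[X]} {s : Fin k → ℂ[X]}
    (hs : IsInvariantChain s) (h : UnimodEquiv M (smithMatrix s a b)) : IsSmithForm M s := by
  obtain ⟨U, V, hU, hV, hUV⟩ := h.symm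
  have hm := hU.card_eq
  have hn := hV.card_eq
  simp only [Fintype.card_fin, Fintype.card_sum] at hm hn
  have hkm : k ≤ m := by omega
  have hkn : k ≤ n := by omega
  let e : Fin k ⊕ a ≃ Fin m := (Equiv.sumCongr (Equiv.refl _)
    (Fintype.equivFinOfCardEq (by omega : Fintype.card a = m - k))).trans (split hkm)
  let f : Fin k ⊕ b ≃ Fin n := (Equiv.sumCongr (Equiv.refl _)
    (Fintype.equivFinOfCardEq (by omega : Fintype.card b = n - k))).trans (split hkn)
  have hel : ∀ i, (e (Sum.inl i)).val = i.val := fun i => by simp [e, split]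
  have her : ∀ i, k ≤ (e (Sum.inr i)).val := fun i => by simp [e, split]
  have hfl : ∀ i, (f (Sum.inl i)).val = i.val := fun i => by simp [f, split]
  have hfr : ∀ i, k ≤ (f (Sum.inr i)).val := fun i => by simp [f, split]
  refine ⟨hkm, hkn, hs.1, hs.2, U.submatrix id e.symm, V.submatrix f.symm id,
    hU.submatrix (Equiv.refl _) _, hV.submatrix _ (Equiv.refl _), ?_⟩
  have hD : (Matrix.of (fun (i : Fin m) (j : Fin n) =>
          if h : i.val < k then (if i.val = j.val then s ⟨i.val, h⟩ else 0) else 0)) =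
      (smithMatrix s a b).submatrix e.symm f.symm := by
    ext1 i j
    obtain ⟨i, rfl⟩ := e.surjective i
    obtain ⟨j, rfl⟩ := f.surjective j
    rcases i with i | i
    · rcases j with j | j
      · simp [hel, hfl, smithMatrix, Matrix.diagonal_apply, Fin.ext_iff]
      · have := hfr j
        have h2 : (i : ℕ) ≠ f (Sum.inr j) := by omega
        simp [hel, smithMatrix, h2]
    · have := her i
      rcases j with j | j <;> simp [smithMatrix, her]
  rw [hD, Matrix.submatrix_mul_equiv, Matrix.submatrix_mul_equiv, hUV]
  simp

theorem UnimodEquiv.rank_map_le {M : Matrix ι κ ℂ[X]} {N : Matrix ι' κ' ℂ[X]}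
    (h : UnimodEquiv M N) :
    (N.map (algebraMap ℂ[X] (RatFunc ℂ))).rank ≤ (M.map (algebraMap ℂ[X] (RatFunc ℂ))).rank := by
  obtain ⟨U, V, -, -, rfl⟩ := h
  rw [Matrix.map_mul, Matrix.map_mul]
  exact (Matrix.rank_mul_le_left _ _).trans (Matrix.rank_mul_le_right _ _)

theorem normalRank_eq_of_unimodEquiv {m n k : ℕ} {a b : Type*} [Fintype a] [Fintype b]
    [DecidableEq a] [DecidableEq b] {M : Matrix (Fin m) (Fin n) ℂ[X]} {s : Fin k → ℂ[X]}
    (hs : IsInvariantChain s) (h : UnimodEquiv M (smithMatrix s a b)) : normalRank M = k := by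
  set φ := algebraMap ℂ[X] (RatFunc ℂ)
  have h1 : normalRank M = ((smithMatrix s a b).map φ).rank :=
    le_antisymm h.symm.rank_map_le h.rank_map_le
  have h2 : ((Matrix.diagonal s).map φ).rank = k := by
    rw [Matrix.rank_of_det_ne_zero, Fintype.card_fin]
    rw [← RingHom.mapMatrix_apply, ← RingHom.map_det, Matrix.det_diagonal]
    exact (map_ne_zero_iff φ (RatFunc.algebraMap_injective ℂ)).2
      (Polynomial.monic_prod_of_monic _ _ fun i _ => hs.1 _).ne_zero
  rw [h1]
  apply le_antisymm
  · rw [smithMatrix_eq, Matrix.map_mul, Matrix.map_mul]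
    refine (Matrix.rank_mul_le_left _ _).trans ((Matrix.rank_mul_le_right _ _).trans h2.le)
  · conv_lhs => rw [← h2]
    rw [diagonal_eq_smithMatrix s a b, Matrix.map_mul, Matrix.map_mul]
    exact (Matrix.rank_mul_le_left _ _).trans (Matrix.rank_mul_le_right _ _)

/-- A pencil `A - λ E` with invertible `E` is regular: up to sign and the factor `det E`, its
determinant is the characteristic polynomial of `A * E⁻¹`. -/
theorem normalRank_pencil {ν : ℕ} (A : Matrix (Fin ν) (Fin ν) ℂ) {E : Matrix (Fin ν) (Fin ν) ℂ}
    (hE : IsUnit E) : normalRank (pencil A E) = ν := by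
  have hdet : IsUnit E.det := (Matrix.isUnit_iff_isUnit_det E).1 hE
  have h1 : pencil A E = -Matrix.charmatrix (A * E⁻¹) * const E := by
    rw [Matrix.charmatrix, Matrix.neg_mul, Matrix.sub_mul]
    simp only [RingHom.mapMatrix_apply]
    change _ = -(_ - const (A * E⁻¹) * const E)
    rw [← const_mul, Matrix.mul_assoc, Matrix.nonsing_inv_mul E hdet, Matrix.mul_one, pencil]
    simp [Matrix.scalar_apply, ← Matrix.smul_eq_diagonal_mul]
  have h2 : (pencil A E).det ≠ 0 := by
    rw [h1, Matrix.det_mul, Matrix.det_neg]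
    refine mul_ne_zero (mul_ne_zero (by simp) (Matrix.charpoly_monic _).ne_zero) ?_
    change (Polynomial.C.mapMatrix E).det ≠ 0
    rw [← RingHom.map_det]
    simpa using hdet.ne_zero
  rw [normalRank, Matrix.rank_of_det_ne_zero, Fintype.card_fin]
  rw [← RingHom.mapMatrix_apply, ← RingHom.map_det]
  exact (map_ne_zero_iff _ (RatFunc.algebraMap_injective ℂ)).2 h2

theorem unimodEquiv_smithMatrix_append {k : ℕ} (s : Fin k → ℂ[X]) (a b : Type*) [Fintype a]
    [Fintype b] [DecidableEq a] [DecidableEq b] :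
    UnimodEquiv (Matrix.fromBlocks (1 : Matrix ι ι ℂ[X]) 0 0 (smithMatrix s a b))
      (smithMatrix (Fin.append (fun _ : Fin (Fintype.card ι) => 1) s) a b) := by
  let e : Fin (Fintype.card ι + k) ≃ ι ⊕ Fin k := finSumFinEquiv.symm.trans
    (Equiv.sumCongr (Fintype.equivFin ι).symm (Equiv.refl _))
  have he1 : ∀ i, e (Fin.castAdd k i) = Sum.inl ((Fintype.equivFin ι).symm i) := fun i => by
    simp [e]
  have he2 : ∀ i, e (Fin.natAdd _ i) = Sum.inr i := fun i => by simp [e]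
  have hne : ∀ (i : Fin (Fintype.card ι)) (j : Fin k), Fin.castAdd k i ≠ Fin.natAdd _ j :=
    fun i j h => by
      have := congrArg Fin.val h
      simp at this
      omega
  convert UnimodEquiv.submatrix (Matrix.fromBlocks (1 : Matrix ι ι ℂ[X]) 0 0 (smithMatrix s a b))
    ((Equiv.sumCongr e (Equiv.refl a)).trans (Equiv.sumAssoc _ _ _))
    ((Equiv.sumCongr e (Equiv.refl b)).trans (Equiv.sumAssoc _ _ _)) using 1
  ext1 i j
  rcases i with i | i
  · rcases j with j | j
    · refine Fin.addCases (fun i => ?_) (fun i => ?_) i <;>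
      refine Fin.addCases (fun j => ?_) (fun j => ?_) j <;>
        simp [smithMatrix, he1, he2, Matrix.diagonal_apply, Matrix.one_apply, hne, (hne _ _).symm]
    · refine Fin.addCases (fun i => ?_) (fun i => ?_) i <;> simp [smithMatrix, he1, he2]
  · rcases j with j | j
    · refine Fin.addCases (fun j => ?_) (fun j => ?_) j <;> simp [smithMatrix, he1, he2]
    · simp [smithMatrix]

theorem IsInvariantChain.append_one {k : ℕ} {s : Fin k → ℂ[X]} (hs : IsInvariantChain s) (p : ℕ) :
    IsInvariantChain (Fin.append (fun _ : Fin p => (1 : ℂ[X])) s) := by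
  refine ⟨fun i => ?_, fun i j => ?_⟩
  · refine Fin.addCases (fun i => ?_) (fun i => ?_) i
    · simp
    · simpa using hs.1 i
  · refine Fin.addCases (fun i _ => by simp) (fun i => ?_) i
    refine Fin.addCases (fun j h => ?_) (fun j h => ?_) j
    · have := Fin.le_def.1 h
      simp at this
      omega
    · simpa using hs.2 i j (by simpa using h)

theorem nontrivialPart_append_one {k : ℕ} (s : Fin k → ℂ[X]) (p : ℕ) :
    nontrivialPart (Fin.append (fun _ : Fin p => (1 : ℂ[X])) s) = nontrivialPart s := by
  classical
  have h : (Finset.univ.val.map (Fin.append (fun _ : Fin p => (1 : ℂ[X])) s)) =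
      Finset.univ.val.map (fun _ : Fin p => (1 : ℂ[X])) + Finset.univ.val.map s := by
    simp only [Fin.univ_val_map, List.ofFn_fin_append, Multiset.coe_add]
  unfold nontrivialPart
  rw [h, Multiset.filter_add]
  simp [Multiset.filter_eq_nil, Multiset.mem_replicate]

/-- Identity blocks do not affect the invariant polynomials different from `1`. -/
theorem nontrivialPart_eq_of_unimodEquiv {k k' : ℕ} {a b a' b' : Type*} [Fintype a] [Fintype b]
    [Fintype a'] [Fintype b'] [DecidableEq a] [DecidableEq b] [DecidableEq a'] [DecidableEq b']
    {s : Fin k → ℂ[X]} {s' : Fin k' → ℂ[X]} (hs : IsInvariantChain s) (hs' : IsInvariantChain s')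
    (h : UnimodEquiv (Matrix.fromBlocks (1 : Matrix ι ι ℂ[X]) 0 0 (smithMatrix s a b))
      (Matrix.fromBlocks (1 : Matrix κ κ ℂ[X]) 0 0 (smithMatrix s' a' b'))) :
    Fintype.card ι + k = Fintype.card κ + k' ∧ nontrivialPart s = nontrivialPart s' := by
  obtain ⟨hk, hss⟩ := (hs'.append_one (Fintype.card κ)).unique (hs.append_one (Fintype.card ι))
    ((unimodEquiv_smithMatrix_append s' a' b').symm.trans
      (h.symm.trans (unimodEquiv_smithMatrix_append s a b)))
  refine ⟨hk, ?_⟩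
  rw [← nontrivialPart_append_one s (Fintype.card ι),
    ← nontrivialPart_append_one s' (Fintype.card κ)]
  generalize Fin.append (fun _ : Fin (Fintype.card ι) => (1 : ℂ[X])) s = t at *
  generalize Fin.append (fun _ : Fin (Fintype.card κ) => (1 : ℂ[X])) s' = t' at *
  generalize Fintype.card ι + k = l at *
  subst hk
  exact congrArg _ (funext hss)

/-- A polynomial matrix of full column rank at every point is equivalent to an identity matrix
bordered by zero rows. -/
theorem unimodEquiv_of_injective {D : Matrix ι κ ℂ[X]}
    (hD : ∀ α : ℂ, Function.Injective (D.map (Polynomial.eval α)).mulVec) :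
    ∃ a : ℕ, UnimodEquiv D (Matrix.fromRows 1 0 : Matrix (κ ⊕ Fin a) κ ℂ[X]) := by
  let e := Fintype.equivFin ι
  let f := Fintype.equivFin κ
  obtain ⟨k, a, b, s, hs, h⟩ := exists_smithMatrix (D.submatrix e.symm f.symm)
  replace h := (UnimodEquiv.submatrix D e.symm f.symm).trans h
  -- no column of the Smith form vanishes at a point
  have hcol : ∀ (α : ℂ) (j : Fin k ⊕ Fin b),
      ∃ i, ((smithMatrix s (Fin a) (Fin b)) i j).eval α ≠ 0 := by
    intro α j
    by_contra! h0
    obtain ⟨U, V, ⟨U', h1, h2⟩, ⟨V', h3, h4⟩, hUV⟩ := h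
    have hDV : D * V = U' * smithMatrix s (Fin a) (Fin b) := by
      rw [← hUV, Matrix.mul_assoc, ← Matrix.mul_assoc U', h2, Matrix.one_mul]
    have hz : (D.map (Polynomial.eval α)).mulVec (fun i => (V i j).eval α) = 0 := by
      ext i
      have := congrArg (Polynomial.eval α) (congrFun (congrFun hDV i) j)
      simp only [Matrix.mul_apply, Polynomial.eval_finsetSum, Polynomial.eval_mul, h0,
        mul_zero, Finset.sum_const_zero] at this
      simpa [Matrix.mulVec, dotProduct] using this
    have hV0 := hD α (hz.trans (Matrix.mulVec_zero _).symm)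
    have := congrArg (Polynomial.eval α) (congrFun (congrFun h4 j) j)
    simp only [Matrix.mul_apply, Polynomial.eval_finsetSum, Polynomial.eval_mul,
      Matrix.one_apply_eq, Polynomial.eval_one] at this
    simp [fun i => (congrFun hV0 i : (V i j).eval α = 0)] at this
  have hb : IsEmpty (Fin b) := ⟨fun j => by
    obtain ⟨i, hi⟩ := hcol 0 (Sum.inr j)
    rcases i with i | i <;> simp [smithMatrix] at hi⟩
  have hs1 : s = fun _ => 1 := by
    ext1 j
    have hroot : ∀ α, ¬ (s j).IsRoot α := by
      intro α h0
      obtain ⟨i, hi⟩ := hcol α (Sum.inl j)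
      rcases i with i | i
      · by_cases hij : i = j
        · subst hij
          simp [smithMatrix] at hi
          exact hi h0
        · simp [smithMatrix, hij] at hi
      · simp [smithMatrix] at hi
    have hdeg : (s j).degree = 0 := by
      by_contra hne
      obtain ⟨z, hz⟩ := IsAlgClosed.exists_root _ hne
      exact hroot z hz
    exact (hs.1 j).natDegree_eq_zero.1 (Polynomial.natDegree_eq_of_degree_eq_some hdeg)
  have hcard : Fintype.card κ = k := by
    obtain ⟨-, V, -, hV, -⟩ := h
    simpa using hV.card_eq
  refine ⟨a, h.trans ?_⟩
  let g : κ ≃ Fin k := Fintype.equivFinOfCardEq hcard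
  convert UnimodEquiv.submatrix (smithMatrix s (Fin a) (Fin b))
    (Equiv.sumCongr g (Equiv.refl (Fin a))) (g.trans (Equiv.sumEmpty (Fin k) (Fin b)).symm) using 1
  subst hs1
  ext1 i j
  rcases i with i | i <;> simp [smithMatrix, Matrix.one_apply]

theorem UnimodEquiv.exists_left_inverse {a : Type*} [Fintype a] [DecidableEq a] {D : Matrix ι κ ℂ[X]}
    (h : UnimodEquiv D (Matrix.fromRows 1 0 : Matrix (κ ⊕ a) κ ℂ[X])) :
    ∃ D' : Matrix κ ι ℂ[X], D' * D = 1 := by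
  obtain ⟨U, V, -, ⟨V', h3, h4⟩, hUV⟩ := h
  refine ⟨V * (Matrix.fromCols 1 0 : Matrix κ (κ ⊕ a) ℂ[X]) * U, ?_⟩
  have hU : U * D = (Matrix.fromRows 1 0 : Matrix (κ ⊕ a) κ ℂ[X]) * V' := by
    rw [← hUV, Matrix.mul_assoc (U * D), h3, Matrix.mul_one]
  rw [Matrix.mul_assoc, hU, Matrix.mul_assoc, ← Matrix.mul_assoc (Matrix.fromCols 1 0) _ V',
    Matrix.fromCols_mul_fromRows]
  simp [h3]

/-- The upper rows of a unimodular matrix are equivalent to `[I 0]` and right invertible. -/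
theorem IsUnimodular.upper {ω : Type*} [Fintype ω] [DecidableEq ω] {M : Matrix ι κ ℂ[X]}
    {N : Matrix ω κ ℂ[X]} (h : IsUnimodular (Matrix.fromRows M N)) :
    UnimodEquiv M (Matrix.fromCols 1 0 : Matrix ι (ι ⊕ ω) ℂ[X]) ∧
      ∃ M' : Matrix κ ι ℂ[X], M * M' = 1 := by
  obtain ⟨G, h1, h2⟩ := h
  have h3 : M * G = Matrix.fromCols 1 0 := by
    rw [Matrix.fromRows_mul] at h1
    ext1 i j
    have := congrFun (congrFun h1 (Sum.inl i)) j
    rw [Matrix.fromRows_apply_inl] at this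
    rw [this]
    rcases j with j | j <;> simp [Matrix.one_apply]
  refine ⟨⟨1, G, .one, ⟨_, h2, h1⟩, by rw [Matrix.one_mul, h3]⟩,
    G * (Matrix.fromRows 1 0 : Matrix (ι ⊕ ω) ι ℂ[X]), ?_⟩
  rw [← Matrix.mul_assoc, h3, Matrix.fromCols_mul_fromRows]
  simp

/-- Collecting the identity blocks of a block diagonal matrix. -/
theorem unimodEquiv_collect {k : ℕ} (s : Fin k → ℂ[X]) (a b ω μ : Type*) [Fintype a] [Fintype b]
    [Fintype ω] [Fintype μ] [DecidableEq a] [DecidableEq b] [DecidableEq ω] [DecidableEq μ] :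
    UnimodEquiv
      (Matrix.fromBlocks (Matrix.fromCols 1 0 : Matrix ι (ι ⊕ ω) ℂ[X]) 0 0
        (Matrix.fromBlocks (smithMatrix s a b) 0 0 (Matrix.fromRows 1 0 : Matrix (κ ⊕ μ) κ ℂ[X])))
      (Matrix.fromBlocks (1 : Matrix (ι ⊕ κ) (ι ⊕ κ) ℂ[X]) 0 0
        (smithMatrix s (a ⊕ μ) (ω ⊕ b))) := by
  let e : (ι ⊕ κ) ⊕ (Fin k ⊕ (a ⊕ μ)) ≃ ι ⊕ ((Fin k ⊕ a) ⊕ (κ ⊕ μ)) :=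
    { toFun := Sum.elim (Sum.elim Sum.inl fun x => Sum.inr (Sum.inr (Sum.inl x)))
        (Sum.elim (fun x => Sum.inr (Sum.inl (Sum.inl x)))
          (Sum.elim (fun x => Sum.inr (Sum.inl (Sum.inr x)))
            fun x => Sum.inr (Sum.inr (Sum.inr x))))
      invFun := Sum.elim (fun x => Sum.inl (Sum.inl x))
        (Sum.elim (Sum.elim (fun x => Sum.inr (Sum.inl x)) fun x => Sum.inr (Sum.inr (Sum.inl x)))
          (Sum.elim (fun x => Sum.inl (Sum.inr x)) fun x => Sum.inr (Sum.inr (Sum.inr x))))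
      left_inv := by rintro ((x | x) | (x | (x | x))) <;> rfl
      right_inv := by rintro (x | ((x | x) | (x | x))) <;> rfl }
  let f : (ι ⊕ κ) ⊕ (Fin k ⊕ (ω ⊕ b)) ≃ (ι ⊕ ω) ⊕ ((Fin k ⊕ b) ⊕ κ) :=
    { toFun := Sum.elim (Sum.elim (fun x => Sum.inl (Sum.inl x)) fun x => Sum.inr (Sum.inr x))
        (Sum.elim (fun x => Sum.inr (Sum.inl (Sum.inl x)))
          (Sum.elim (fun x => Sum.inl (Sum.inr x)) fun x => Sum.inr (Sum.inl (Sum.inr x))))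
      invFun := Sum.elim
        (Sum.elim (fun x => Sum.inl (Sum.inl x)) fun x => Sum.inr (Sum.inr (Sum.inl x)))
        (Sum.elim (Sum.elim (fun x => Sum.inr (Sum.inl x)) fun x => Sum.inr (Sum.inr (Sum.inr x)))
          (fun x => Sum.inl (Sum.inr x)))
      left_inv := by rintro ((x | x) | (x | (x | x))) <;> rfl
      right_inv := by rintro ((x | x) | ((x | x) | x)) <;> rfl }
  convert UnimodEquiv.submatrix _ e f using 1
  ext1 i j
  rcases i with (i | i) | (i | (i | i)) <;> rcases j with (j | j) | (j | (j | j)) <;>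
    simp [e, f, smithMatrix, Matrix.one_apply]

end SmithConsequences

/-! ### Unimodular completion and the generalized Sylvester equation -/

section Completion

theorem exists_invertible_of_ne_zero {κ : Type} [Fintype κ] [DecidableEq κ] {x : κ → ℂ}
    (hx : x ≠ 0) :
    ∃ (c : ℕ) (T : Matrix κ (Unit ⊕ Fin c) ℂ) (T' : Matrix (Unit ⊕ Fin c) κ ℂ),
      T * T' = 1 ∧ T' * T = 1 ∧ ∀ i, T i (Sum.inl ()) = x i := by
  classical
  have hli : LinearIndepOn ℂ id ({x} : Set (κ → ℂ)) := (linearIndepOn_singleton_iff ℂ).2 hx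
  let b₀ := Module.Basis.extend hli
  have : Finite (hli.extend (Set.subset_univ _)) := Module.Finite.finite_basis b₀
  have := Fintype.ofFinite (hli.extend (Set.subset_univ _))
  let x₀ : hli.extend (Set.subset_univ _) := ⟨x, hli.subset_extend _ rfl⟩
  obtain ⟨c, hc⟩ : ∃ c, Fintype.card (hli.extend (Set.subset_univ _)) = c + 1 :=
    Nat.exists_eq_succ_of_ne_zero (Fintype.card_pos_iff.2 ⟨x₀⟩).ne'
  let e : hli.extend (Set.subset_univ _) ≃ Unit ⊕ Fin c :=
    Fintype.equivOfCardEq (by simp [hc, add_comm])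
  let b := b₀.reindex (e.trans (Equiv.swap (e x₀) (Sum.inl ())))
  refine ⟨c, (Pi.basisFun ℂ κ).toMatrix b, b.toMatrix (Pi.basisFun ℂ κ),
    Module.Basis.toMatrix_mul_toMatrix_flip _ _, Module.Basis.toMatrix_mul_toMatrix_flip _ _,
    fun i => ?_⟩
  have h1 : b (Sum.inl ()) = x := by
    simp [b, b₀, x₀]
  rw [Module.Basis.toMatrix_apply, h1]
  simp

/-- A pencil of full row rank at every finite point and at infinity, with at least one row, has a
nonzero constant column after constant column operations. -/
theorem exists_mulVec_eq_zero_and_ne_zero {ρ : ℕ} {κ : Type} [Fintype κ]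
    {A E : Matrix (Fin (ρ + 1)) κ ℂ}
    (hA : ∀ α : ℂ, Function.Surjective (A - α • E).mulVec) (hE : Function.Surjective E.mulVec) :
    ∃ x, E.mulVec x = 0 ∧ A.mulVec x ≠ 0 := by
  classical
  by_contra! h
  obtain ⟨E', hE'⟩ := Matrix.mulVec_surjective_iff_exists_right_inverse.1 hE
  -- otherwise `A` factors through `E`, and an eigenvector gives a point where the rank drops
  have hAE : A = A * E' * E := by
    refine Matrix.toLin'.injective (LinearMap.ext fun v => ?_)
    rw [Matrix.toLin'_apply, Matrix.toLin'_apply]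
    have h0 : E.mulVec (v - (E' * E).mulVec v) = 0 := by
      rw [Matrix.mulVec_sub, Matrix.mulVec_mulVec, ← Matrix.mul_assoc, hE', Matrix.one_mul, sub_self]
    have h1 := h _ h0
    rw [Matrix.mulVec_sub, sub_eq_zero, Matrix.mulVec_mulVec, ← Matrix.mul_assoc] at h1
    exact h1
  obtain ⟨α, hα⟩ := Module.End.exists_eigenvalue (Matrix.toLin' (A * E')ᵀ)
  obtain ⟨y, hy⟩ := hα.exists_hasEigenvector
  have hy1 : Matrix.vecMul y (A * E') = α • y := by
    have := hy.apply_eq_smul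
    rwa [Matrix.toLin'_apply, Matrix.mulVec_transpose] at this
  have hy2 : Matrix.vecMul y (A - α • E) = 0 := by
    rw [hAE, Matrix.vecMul_sub, ← Matrix.vecMul_vecMul, hy1, Matrix.vecMul_smul, Matrix.smul_vecMul,
      sub_self]
  refine hy.2 (funext fun i => ?_)
  obtain ⟨z, hz⟩ := hA α (Pi.single i 1)
  have h3 : y ⬝ᵥ (A - α • E).mulVec z = 0 := by
    rw [Matrix.dotProduct_mulVec, hy2, zero_dotProduct]
  rw [hz] at h3
  simpa using h3

/-- A pencil which has full row rank at every finite point and at infinity (only right Kronecker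
blocks) is completed to a unimodular matrix by constant rows. -/
theorem exists_unimodular_completion (ρ : ℕ) {κ : Type} [Fintype κ] [DecidableEq κ]
    (A E : Matrix (Fin ρ) κ ℂ)
    (hA : ∀ α : ℂ, Function.Surjective (A - α • E).mulVec) (hE : Function.Surjective E.mulVec) :
    ∃ (w : ℕ) (W : Matrix (Fin w) κ ℂ),
      IsUnimodular (Matrix.fromRows (pencil A E) (const W)) := by
  induction ρ generalizing κ with
  | zero =>
    let e : Fin 0 ⊕ Fin (Fintype.card κ) ≃ κ :=
      (Equiv.emptySum _ _).trans (Fintype.equivFin κ).symm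
    refine ⟨Fintype.card κ, (1 : Matrix κ κ ℂ).submatrix (Fintype.equivFin κ).symm id, ?_⟩
    convert (IsUnimodular.one (ι := κ)).submatrix e (Equiv.refl κ) using 1
    ext1 i j
    rcases i with i | i
    · exact i.elim0
    · simp [const_apply, e, Matrix.one_apply, apply_ite Polynomial.C]
      congr
  | succ ρ ih =>
    obtain ⟨x, hEx, hAx⟩ := exists_mulVec_eq_zero_and_ne_zero hA hE
    have hx : x ≠ 0 := by
      rintro rfl
      exact hAx (Matrix.mulVec_zero _)
    obtain ⟨c, T, T', hT1, hT2, hT⟩ := exists_invertible_of_ne_zero hx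
    obtain ⟨ρ', S', S, hS1, hS2, hS⟩ := exists_invertible_of_ne_zero hAx
    obtain rfl : ρ' = ρ := by
      have := Matrix.square_of_invertible S' S hS1 hS2
      simp at this
      omega
    have hTx : ∀ {ι' : Type} (M : Matrix ι' κ ℂ) i, (M * T) i (Sum.inl ()) = M.mulVec x i := by
      intro ι' M i
      simp [Matrix.mul_apply, Matrix.mulVec, dotProduct, hT]
    -- in the new bases the first column is that of `1` in `A` and vanishes in `E`
    obtain ⟨a, A₂, hA₂⟩ : ∃ a A₂, S * A * T =
        Matrix.fromBlocks (1 : Matrix Unit Unit ℂ) a 0 A₂ := by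
      refine ⟨(S * A * T).toBlocks₁₂, (S * A * T).toBlocks₂₂, ?_⟩
      have hAx' : A.mulVec x = S'.mulVec (Pi.single (Sum.inl ()) 1) := by
        ext i
        rw [Matrix.mulVec_single_one, ← hS]
        rfl
      have h1 : ∀ i, (S * A * T) i (Sum.inl ()) = if i = Sum.inl () then 1 else 0 := by
        intro i
        rw [hTx, ← Matrix.mulVec_mulVec, hAx', Matrix.mulVec_mulVec, hS2, Matrix.one_mulVec,
          Pi.single_apply]
      have h2 : (S * A * T).toBlocks₁₁ = 1 := by
        ext i j
        exact (h1 (Sum.inl i)).trans (by simp)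
      have h3 : (S * A * T).toBlocks₂₁ = 0 := by
        ext i j
        exact (h1 (Sum.inr i)).trans (by simp)
      rw [← h2, ← h3, Matrix.fromBlocks_toBlocks]
    obtain ⟨e, E₂, hE₂⟩ : ∃ e E₂, S * E * T =
        Matrix.fromBlocks (0 : Matrix Unit Unit ℂ) e 0 E₂ := by
      refine ⟨(S * E * T).toBlocks₁₂, (S * E * T).toBlocks₂₂, ?_⟩
      have h1 : ∀ i, (S * E * T) i (Sum.inl ()) = 0 := by
        intro i
        rw [hTx, ← Matrix.mulVec_mulVec, hEx, Matrix.mulVec_zero, Pi.zero_apply]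
      have h2 : (S * E * T).toBlocks₁₁ = 0 := by
        ext i j
        exact h1 (Sum.inl i)
      have h3 : (S * E * T).toBlocks₂₁ = 0 := by
        ext i j
        exact h1 (Sum.inr i)
      conv_lhs => rw [← Matrix.fromBlocks_toBlocks (S * E * T), h2, h3]
    have hsurj : ∀ (M : Matrix (Fin (ρ' + 1)) κ ℂ) (M₁₁ : Matrix Unit Unit ℂ) M₁₂ M₂,
        Function.Surjective M.mulVec → S * M * T = Matrix.fromBlocks M₁₁ M₁₂ 0 M₂ →
        Function.Surjective M₂.mulVec := by
      intro M M₁₁ M₁₂ M₂ hM h y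
      obtain ⟨v, hv⟩ := hM (S'.mulVec (Sum.elim (0 : Unit → ℂ) y))
      refine ⟨(T'.mulVec v) ∘ Sum.inr, ?_⟩
      have h1 : (S * M * T).mulVec (T'.mulVec v) = Sum.elim (0 : Unit → ℂ) y := by
        rw [Matrix.mulVec_mulVec, Matrix.mul_assoc, hT1, Matrix.mul_one, ← Matrix.mulVec_mulVec, hv,
          Matrix.mulVec_mulVec, hS2, Matrix.one_mulVec]
      rw [h, Matrix.fromBlocks_mulVec] at h1
      have h2 := congrArg (fun u : Unit ⊕ Fin ρ' → ℂ => u ∘ Sum.inr) h1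
      simpa using h2
    obtain ⟨w, W, hW⟩ := ih A₂ E₂
      (fun α => hsurj (A - α • E) (1 - α • 0) (a - α • e) _ (hA α) (by
        rw [Matrix.mul_sub, Matrix.sub_mul, Matrix.mul_smul, Matrix.smul_mul, hA₂, hE₂,
          Matrix.fromBlocks_smul]
        ext i j
        rcases i with i | i <;> rcases j with j | j <;> simp))
      (hsurj E _ _ _ hE hE₂)
    refine ⟨w, (Matrix.fromCols 0 W : Matrix (Fin w) (Unit ⊕ Fin c) ℂ) * T', ?_⟩
    have h2 : pencil A E = const S' *
        (Matrix.fromBlocks (1 : Matrix Unit Unit ℂ[X]) (pencil a e) 0 (pencil A₂ E₂) :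
          Matrix (Unit ⊕ Fin ρ') (Unit ⊕ Fin c) ℂ[X]) * const T' := by
      have : Matrix.fromBlocks (1 : Matrix Unit Unit ℂ[X]) (pencil a e) 0 (pencil A₂ E₂) =
          pencil (S * A * T) (S * E * T) := by
        rw [hA₂, hE₂]
        ext1 i j
        rcases i with i | i <;> rcases j with j | j <;> simp [pencil_apply]
      rw [this, const_mul_pencil, pencil_mul_const]
      congr 1 <;>
      · simp only [← Matrix.mul_assoc]
        rw [hS1, Matrix.one_mul, Matrix.mul_assoc, hT1, Matrix.mul_one]
    have h3 : IsUnimodular (Matrix.fromRows (Matrix.fromBlocks (1 : Matrix Unit Unit ℂ[X])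
        (pencil a e) 0 (pencil A₂ E₂)) (Matrix.fromCols 0 (const W))) := by
      convert ((IsUnimodular.one (ι := Unit)).fromBlocks_upper
        (pencil a e) hW).submatrix (Equiv.sumAssoc Unit (Fin ρ') (Fin w)) (Equiv.refl _) using 1
      ext1 i j
      rcases i with (i | i) | i <;> rcases j with j | j <;> simp
    have h4 := (((IsUnimodular.const hS1 hS2).fromBlocks_upper 0
      (IsUnimodular.one (ι := Fin w))).mul h3).mul (.const hT2 hT1)
    convert h4 using 1
    rw [Matrix.fromBlocks_mul_fromRows, Matrix.fromRows_mul, h2]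
    rw [const_mul, const_fromCols]
    simp

end Completion

section Sylvester

variable {ι κ ν : Type*} [Fintype ι] [Fintype κ] [Fintype ν] [DecidableEq ι] [DecidableEq κ]
  [DecidableEq ν]

/-- The coefficient matrices of the inverse of a unimodular pencil `A - λ E` are
`(A⁻¹ E) ^ k A⁻¹`; as there are finitely many, `A⁻¹ E` is nilpotent. -/
theorem IsUnimodular.exists_inverse_nilpotent {A E : Matrix ι κ ℂ} (h : IsUnimodular (pencil A E)) :
    ∃ G : Matrix κ ι ℂ, A * G = 1 ∧ G * A = 1 ∧ IsNilpotent (G * E) := by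
  obtain ⟨H, h1, h2⟩ := h
  let G : ℕ → Matrix κ ι ℂ := fun k => Matrix.of fun i j => (H i j).coeff k
  have hcoeff0 : A * G 0 = 1 := by
    ext i j
    have := congrArg (Polynomial.coeff · 0) (congrFun (congrFun h1 i) j)
    simpa [Matrix.mul_apply, pencil_apply, sub_mul, Polynomial.finsetSum_coeff, mul_assoc,
      Matrix.one_apply, apply_ite (Polynomial.coeff · 0), G] using this
  have hcoeff0' : G 0 * A = 1 := by
    ext i j
    have := congrArg (Polynomial.coeff · 0) (congrFun (congrFun h2 i) j)
    simpa [Matrix.mul_apply, pencil_apply, mul_sub, Polynomial.finsetSum_coeff,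
      Matrix.one_apply, apply_ite (Polynomial.coeff · 0), G] using this
  have hcoeff : ∀ k, A * G (k + 1) = E * G k := by
    intro k
    ext i j
    have := congrArg (Polynomial.coeff · (k + 1)) (congrFun (congrFun h1 i) j)
    have h0 : ((1 : Matrix ι ι ℂ[X]) i j).coeff (k + 1) = 0 := by
      rw [Matrix.one_apply]; split_ifs <;> simp [Polynomial.coeff_one]
    simp only [h0, Matrix.mul_apply, pencil_apply, sub_mul, Polynomial.finsetSum_coeff, mul_assoc,
      Polynomial.coeff_sub, Polynomial.coeff_C_mul, Polynomial.coeff_X_mul, Finset.sum_sub_distrib,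
      sub_eq_zero] at this
    simpa [Matrix.mul_apply, G] using this
  have hpow : ∀ k, G k = (G 0 * E) ^ k * G 0 := by
    intro k
    induction k with
    | zero => simp
    | succ k ih =>
      rw [pow_succ', Matrix.mul_assoc (G 0 * E), ← ih, Matrix.mul_assoc, ← hcoeff, ← Matrix.mul_assoc,
        hcoeff0', Matrix.one_mul]
  refine ⟨G 0, hcoeff0, hcoeff0', (∑ i, ∑ j, (H i j).natDegree) + 1, ?_⟩
  have hG : G ((∑ i, ∑ j, (H i j).natDegree) + 1) = 0 := by
    ext i j
    refine Polynomial.coeff_eq_zero_of_natDegree_lt (Nat.lt_succ_of_le ?_)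
    exact (Finset.single_le_sum (f := fun j => (H i j).natDegree) (fun _ _ => Nat.zero_le _)
      (Finset.mem_univ j)).trans (Finset.single_le_sum (f := fun i => ∑ j, (H i j).natDegree)
      (fun _ _ => Nat.zero_le _) (Finset.mem_univ i))
  rw [hpow] at hG
  have := congrArg (· * A) hG
  simpa [Matrix.mul_assoc, hcoeff0'] using this

/-- The generalized Sylvester equation is solvable for a unimodular pencil `A - λ E`, which has no
finite eigenvalues, and a pencil `A₂ - λ E₂` without infinite eigenvalues. -/
theorem exists_sylvester {A E : Matrix ι κ ℂ} (h : IsUnimodular (pencil A E))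
    (A₂ : Matrix ν ν ℂ) {E₂ : Matrix ν ν ℂ} (hE₂ : IsUnit E₂) (X Y : Matrix ι ν ℂ) :
    ∃ (R : Matrix κ ν ℂ) (L : Matrix ι ν ℂ), A * R - L * A₂ = X ∧ E * R - L * E₂ = Y := by
  obtain ⟨G, h1, h2, q, hq⟩ := h.exists_inverse_nilpotent
  have hdet : IsUnit E₂.det := (Matrix.isUnit_iff_isUnit_det E₂).1 hE₂
  set N := G * E with hN
  set J := E₂⁻¹ * A₂ with hJ
  set W := G * (X - Y * J) with hW
  -- `R - N R J = W` is solved by a Neumann series, finite because `N` is nilpotent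
  set R := ∑ k ∈ Finset.range q, N ^ k * W * J ^ k with hR
  have hRW : R - N * R * J = W := by
    have h3 : N * R * J = ∑ k ∈ Finset.range q, N ^ (k + 1) * W * J ^ (k + 1) := by
      rw [hR, Matrix.mul_sum, Matrix.sum_mul]
      refine Finset.sum_congr rfl fun k _ => ?_
      rw [pow_succ', pow_succ]
      simp only [Matrix.mul_assoc]
    rw [h3, hR, ← Finset.sum_sub_distrib, Finset.sum_range_sub' (fun k => N ^ k * W * J ^ k), hq]
    simp
  have hER : E * R = A * (N * R) := by
    rw [hN, ← Matrix.mul_assoc, ← Matrix.mul_assoc, h1, Matrix.one_mul]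
  refine ⟨R, (E * R - Y) * E₂⁻¹, ?_, ?_⟩
  · have h4 : A * W = X - Y * J := by rw [hW, ← Matrix.mul_assoc, h1, Matrix.one_mul]
    rw [← hRW, Matrix.mul_sub] at h4
    rw [Matrix.mul_assoc _ E₂⁻¹, ← hJ, Matrix.sub_mul, hER, Matrix.mul_assoc A]
    rw [sub_eq_iff_eq_add] at h4
    rw [h4]
    abel
  · rw [Matrix.mul_assoc, Matrix.nonsing_inv_mul _ hdet, Matrix.mul_one]
    abel

end Sylvester

/-! ### Adapted unitary matrices and reducing subspaces -/

section Flags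

theorem IsUnitary.card_eq {ι κ : Type*} [Fintype ι] [Fintype κ] [DecidableEq ι] [DecidableEq κ]
    {Z : Matrix ι κ ℂ} (hZ : IsUnitary Z) : Fintype.card ι = Fintype.card κ :=
  Matrix.square_of_invertible Z Zᴴ hZ.2 hZ.1

theorem IsUnitary.mul {ι κ μ : Type*} [Fintype ι] [Fintype κ] [Fintype μ] [DecidableEq ι]
    [DecidableEq κ] [DecidableEq μ] {Z : Matrix ι κ ℂ} {Y : Matrix κ μ ℂ} (hZ : IsUnitary Z)
    (hY : IsUnitary Y) : IsUnitary (Z * Y) := by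
  constructor
  · rw [Matrix.conjTranspose_mul, Matrix.mul_assoc, ← Matrix.mul_assoc Zᴴ, hZ.1, Matrix.one_mul, hY.1]
  · rw [Matrix.conjTranspose_mul, Matrix.mul_assoc, ← Matrix.mul_assoc Y, hY.2, Matrix.one_mul, hZ.2]

theorem IsUnitary.one_fromBlocks {κ μ ν : Type*} [Fintype κ] [Fintype μ] [Fintype ν]
    [DecidableEq κ] [DecidableEq μ] [DecidableEq ν] {Y : Matrix κ μ ℂ} (hY : IsUnitary Y) :
    IsUnitary (Matrix.fromBlocks (1 : Matrix ν ν ℂ) 0 0 Y) := by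
  constructor <;>
    simp [Matrix.fromBlocks_conjTranspose, Matrix.fromBlocks_multiply, hY.1, hY.2]

/-- A unitary matrix whose first columns span a given subspace. -/
theorem exists_isUnitary_adapted {κ : Type*} [Fintype κ] [DecidableEq κ]
    (S : Submodule ℂ (κ → ℂ)) :
    ∃ (a b : ℕ) (Z : Matrix κ (Fin a ⊕ Fin b) ℂ), IsUnitary Z ∧
      ∀ y, Z.mulVec y ∈ S ↔ ∀ j, y (Sum.inr j) = 0 := by
  classical
  let φ := WithLp.linearEquiv 2 ℂ (κ → ℂ)
  let S' : Submodule ℂ (EuclideanSpace ℂ κ) := S.comap φ.toLinearMap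
  let o := stdOrthonormalBasis ℂ S'
  set a := Module.finrank ℂ S' with ha
  have hle : a ≤ Fintype.card κ := by
    rw [ha, ← finrank_euclideanSpace (𝕜 := ℂ) (ι := κ)]
    exact S'.finrank_le
  obtain ⟨b, hb⟩ := Nat.exists_eq_add_of_le hle
  let v : Fin a ⊕ Fin b → EuclideanSpace ℂ κ := Sum.elim (fun i => (o i : EuclideanSpace ℂ κ)) 0
  have hv : Orthonormal ℂ ((Set.range (Sum.inl : Fin a → Fin a ⊕ Fin b)).domRestrict v) := by
    have h1 : Orthonormal ℂ (fun i => (o i : EuclideanSpace ℂ κ)) :=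
      o.orthonormal.comp_linearIsometry S'.subtypeₗᵢ
    let e := Equiv.ofInjective (Sum.inl : Fin a → Fin a ⊕ Fin b) Sum.inl_injective
    have h2 := h1.comp e.symm e.symm.injective
    convert h2 using 1
    ext1 ⟨x, i, rfl⟩
    have : e.symm ⟨Sum.inl i, i, rfl⟩ = i := by
      rw [Equiv.symm_apply_eq]; rfl
    simp [v, this, Set.domRestrict]
  obtain ⟨B, hB⟩ := hv.exists_orthonormalBasis_extension_of_card_eq (by simp [hb])
  have hBl : ∀ i, B (Sum.inl i) = (o i : EuclideanSpace ℂ κ) := fun i => hB _ ⟨i, rfl⟩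
  have hZ1 : IsUnitary (Matrix.of fun (i : κ) j => B j i) := by
    have h1 : (Matrix.of fun (i : κ) j => B j i)ᴴ * (Matrix.of fun (i : κ) j => B j i) = 1 := by
      ext i j
      have := orthonormal_iff_ite.1 B.orthonormal i j
      rw [Matrix.one_apply, ← this]
      simp [Matrix.mul_apply, PiLp.inner_apply, mul_comm]
    refine ⟨h1, ?_⟩
    rwa [Matrix.mul_eq_one_comm_of_card_eq]
    simp [hb]
  have hsum : ∀ y, (Matrix.of fun (i : κ) j => B j i).mulVec y = φ (∑ j, y j • B j) := by
    intro y
    ext i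
    simp [φ, Matrix.mulVec, dotProduct, mul_comm]
  refine ⟨a, b, Matrix.of fun i j => B j i, hZ1, fun y => ?_⟩
  rw [hsum]
  change ∑ j, y j • B j ∈ S' ↔ _
  constructor
  · intro h j
    have h1 : inner ℂ (B (Sum.inr j)) (∑ j, y j • B j) = y (Sum.inr j) :=
      B.orthonormal.inner_right_fintype y _
    rw [← h1]
    have h2 := congrArg Subtype.val (o.sum_repr ⟨_, h⟩)
    simp only [Submodule.coe_sum, Submodule.coe_smul] at h2
    rw [← h2, inner_sum]
    refine Finset.sum_eq_zero fun i _ => ?_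
    rw [inner_smul_right, ← hBl, orthonormal_iff_ite.1 B.orthonormal]
    simp
  · intro h
    rw [Fintype.sum_sum_type]
    simp only [h, zero_smul, Finset.sum_const_zero, add_zero, hBl]
    exact Submodule.sum_mem _ fun i _ => S'.smul_mem _ (o i).2

/-- A unitary matrix adapted to `S` may still be changed by any unitary matrix `Y` in the last
coordinates, and `f` expresses the subspaces above `S` in these coordinates. Adapted matrices of a
flag are obtained by iteration. -/
theorem exists_isUnitary_refine {κ : Type*} [Fintype κ] [DecidableEq κ]
    (S : Submodule ℂ (κ → ℂ)) :
    ∃ (a b : ℕ) (f : Submodule ℂ (κ → ℂ) →o Submodule ℂ (Fin b → ℂ)),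
      ∀ {γ : Type} [Fintype γ] [DecidableEq γ] (Y : Matrix (Fin b) γ ℂ), IsUnitary Y →
        ∃ Z : Matrix κ (Fin a ⊕ γ) ℂ, IsUnitary Z ∧
          (∀ y, Z.mulVec y ∈ S ↔ ∀ j, y (Sum.inr j) = 0) ∧
          ∀ S', S ≤ S' → ∀ y, Z.mulVec y ∈ S' ↔ Y.mulVec (y ∘ Sum.inr) ∈ f S' := by
  obtain ⟨a, b, Z, hZ, hZS⟩ := exists_isUnitary_adapted S
  let L : (Fin b → ℂ) →ₗ[ℂ] (κ → ℂ) := Z.mulVecLin ∘ₗ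
    { toFun := fun y => Sum.elim 0 y
      map_add' := fun x y => by ext i; rcases i with i | i <;> simp
      map_smul' := fun c x => by ext i; rcases i with i | i <;> simp }
  refine ⟨a, b, ⟨fun S' => S'.comap L, fun _ _ h => Submodule.comap_mono h⟩, ?_⟩
  intro γ _ _ Y hY
  have hmul : ∀ y, (Z * Matrix.fromBlocks (1 : Matrix (Fin a) (Fin a) ℂ) 0 0 Y).mulVec y =
      Z.mulVec (Sum.elim (y ∘ Sum.inl) (Y.mulVec (y ∘ Sum.inr))) := by
    intro y
    rw [← Matrix.mulVec_mulVec, Matrix.fromBlocks_mulVec]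
    simp
  refine ⟨Z * Matrix.fromBlocks 1 0 0 Y, hZ.mul hY.one_fromBlocks, fun y => ?_, fun S' hS' y => ?_⟩
  · rw [hmul, hZS]
    simp only [Sum.elim_inr]
    constructor
    · intro h
      have h1 : Y.mulVec (y ∘ Sum.inr) = 0 := funext h
      have h2 : y ∘ Sum.inr = 0 := by
        have := congrArg (Yᴴ.mulVec ·) h1
        simpa [Matrix.mulVec_mulVec, hY.1] using this
      exact fun j => congrFun h2 j
    · intro h
      have : y ∘ Sum.inr = 0 := funext h
      simp [this]
  · rw [hmul]
    have h1 : Sum.elim (y ∘ Sum.inl) (Y.mulVec (y ∘ Sum.inr)) =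
        Sum.elim (y ∘ Sum.inl) (0 : Fin b → ℂ) +
          Sum.elim (0 : Fin a → ℂ) (Y.mulVec (y ∘ Sum.inr)) := by
      ext i; rcases i with i | i <;> simp
    rw [h1, Matrix.mulVec_add, Submodule.add_mem_iff_right]
    · rfl
    · exact hS' ((hZS _).2 (by simp))

theorem exists_isUnitary_flag_two {κ : Type*} [Fintype κ] [DecidableEq κ]
    {S₁ S₂ : Submodule ℂ (κ → ℂ)} (h : S₁ ≤ S₂) :
    ∃ (a b c : ℕ) (Z : Matrix κ (Fin a ⊕ Fin b ⊕ Fin c) ℂ), IsUnitary Z ∧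
      (∀ y, Z.mulVec y ∈ S₁ ↔ ∀ j, y (Sum.inr j) = 0) ∧
      ∀ y, Z.mulVec y ∈ S₂ ↔ ∀ j, y (Sum.inr (Sum.inr j)) = 0 := by
  obtain ⟨a, b', f, hf⟩ := exists_isUnitary_refine S₁
  obtain ⟨b, c, Y, hY, h1⟩ := exists_isUnitary_adapted (f S₂)
  obtain ⟨Z, hZ, h2, h3⟩ := hf Y hY
  exact ⟨a, b, c, Z, hZ, h2, fun y => (h3 S₂ h y).trans (h1 _)⟩

theorem exists_isUnitary_flag_three {κ : Type*} [Fintype κ] [DecidableEq κ]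
    {S₁ S₂ S₃ : Submodule ℂ (κ → ℂ)} (h : S₁ ≤ S₂) (h' : S₂ ≤ S₃) :
    ∃ (a b c e : ℕ) (Z : Matrix κ (Fin a ⊕ Fin b ⊕ Fin c ⊕ Fin e) ℂ), IsUnitary Z ∧
      (∀ y, Z.mulVec y ∈ S₁ ↔ ∀ j, y (Sum.inr j) = 0) ∧
      (∀ y, Z.mulVec y ∈ S₂ ↔ ∀ j, y (Sum.inr (Sum.inr j)) = 0) ∧
      ∀ y, Z.mulVec y ∈ S₃ ↔ ∀ j, y (Sum.inr (Sum.inr (Sum.inr j))) = 0 := by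
  obtain ⟨a, b', f, hf⟩ := exists_isUnitary_refine S₁
  obtain ⟨b, c, e, Y, hY, h1, h4⟩ := exists_isUnitary_flag_two (f.monotone h')
  obtain ⟨Z, hZ, h2, h3⟩ := hf Y hY
  exact ⟨a, b, c, e, Z, hZ, h2, fun y => (h3 S₂ h y).trans (h1 _),
    fun y => (h3 S₃ (h.trans h') y).trans (h4 _)⟩

end Flags

section ReducingSubspaces

variable {𝒳 𝒴 : Type*} [AddCommGroup 𝒳] [Module ℂ 𝒳] [AddCommGroup 𝒴] [Module ℂ 𝒴]

/-- The reducing subspaces of the pencil `A - λ E` inside a subspace `S`. The larger one, `V`, is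
the greatest subspace of `S` with `A V ≤ E V`: it carries the right Kronecker and the finite
structure. The smaller one, `W`, is the least subspace with `V ⊓ E⁻¹ (A W) ≤ W`: it carries the
right Kronecker structure. -/
theorem exists_reducing_subspaces (A E : 𝒳 →ₗ[ℂ] 𝒴) (S : Submodule ℂ 𝒳) :
    ∃ W V : Submodule ℂ 𝒳, W ≤ V ∧ V ≤ S ∧
      (∀ x ∈ W, A x ∈ W.map E) ∧ (∀ x ∈ V, A x ∈ V.map E) ∧
      (∀ (α : ℂ), ∀ y ∈ W.map E, ∃ x ∈ W, A x - α • E x = y) ∧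
      (∀ x ∈ V, E x ∈ W.map E → x ∈ W) ∧
      (∀ (α : ℂ), ∀ x ∈ S, A x - α • E x ∈ V.map E → x ∈ V) := by
  let g : Submodule ℂ 𝒳 →o Submodule ℂ 𝒳 :=
    ⟨fun X => S ⊓ (X.map E).comap A, fun X Y h =>
      inf_le_inf_left _ (Submodule.comap_mono (Submodule.map_mono h))⟩
  let V := OrderHom.gfp g
  have hV : S ⊓ (V.map E).comap A = V := g.map_gfp
  let f : Submodule ℂ 𝒳 →o Submodule ℂ 𝒳 :=
    ⟨fun X => V ⊓ (X.map A).comap E, fun X Y h =>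
      inf_le_inf_left _ (Submodule.comap_mono (Submodule.map_mono h))⟩
  let W := OrderHom.lfp f
  have hW : V ⊓ (W.map A).comap E = W := f.map_lfp
  have hWV : W ≤ V := by rw [← hW]; exact inf_le_left
  have hVS : V ≤ S := by rw [← hV]; exact inf_le_left
  have hAV : ∀ x ∈ V, A x ∈ V.map E := fun x hx => by
    rw [← hV] at hx; exact hx.2
  have hEW : ∀ x ∈ W, E x ∈ W.map A := fun x hx => by
    rw [← hW] at hx; exact hx.2
  have hmem : ∀ x ∈ V, E x ∈ W.map A → x ∈ W := fun x hx h => by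
    rw [← hW]; exact ⟨hx, h⟩
  have hmap : W.map A = W.map E := by
    apply le_antisymm
    · rintro _ ⟨x, hx, rfl⟩
      obtain ⟨z, hz, hzx⟩ := hAV x (hWV hx)
      exact ⟨z, hmem z hz ⟨x, hx, hzx.symm⟩, hzx⟩
    · rintro _ ⟨x, hx, rfl⟩
      exact hEW x hx
  refine ⟨W, V, hWV, hVS, fun x hx => hmap ▸ ⟨x, hx, rfl⟩, hAV, fun α => ?_,
    fun x hx h => hmem x hx (hmap ▸ h), fun α x hx h => ?_⟩
  · -- the vectors of `W` that `A` maps into `(A - α E) W` already contain `W`, by minimality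
    let W' : Submodule ℂ 𝒳 := W ⊓ (W.map (A - α • E)).comap A
    have hW' : W ≤ W' := by
      refine f.lfp_le ?_
      rintro x ⟨hxV, s, ⟨hsW, u, huW, hus⟩, hsx⟩
      have hxW : x ∈ W := hmem x hxV ⟨s, hsW, hsx⟩
      refine ⟨hxW, x + α • u, W.add_mem hxW (W.smul_mem α huW), ?_⟩
      rw [map_add, map_smul, hus, hsx]
      simp
    intro y hy
    rw [← hmap] at hy
    obtain ⟨s, hs, rfl⟩ := hy
    obtain ⟨x, hx, hxs⟩ := (hW' hs).2
    exact ⟨x, hx, by simpa using hxs⟩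
  · -- adjoining `x` to `V` gives a subspace that still satisfies the condition defining `V`
    have hsup : V ⊔ Submodule.span ℂ {x} ≤ V := by
      refine g.le_gfp (le_inf (sup_le hVS ?_) (sup_le ?_ ?_))
      · rwa [Submodule.span_singleton_le_iff_mem]
      · exact fun z hz => Submodule.map_mono le_sup_left (hAV z hz)
      · rw [Submodule.span_singleton_le_iff_mem, Submodule.mem_comap]
        have h1 : A x = (A x - α • E x) + E (α • x) := by simp
        rw [h1]
        refine Submodule.add_mem _ (Submodule.map_mono le_sup_left h) ⟨α • x, ?_, rfl⟩
        exact Submodule.smul_mem _ _ (le_sup_right (a := V) (Submodule.mem_span_singleton_self x))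
    exact hsup (le_sup_right (a := V) (Submodule.mem_span_singleton_self x))

end ReducingSubspaces

/-! ### The unitary block triangular form -/

section Decomposition

theorem eq_fromBlocks_of_col_eq_zero {ι ι' κ κ' : Type*} {M : Matrix (ι ⊕ ι') (κ ⊕ κ') ℂ}
    (h : ∀ i j, M (Sum.inr i) (Sum.inl j) = 0) :
    M = Matrix.fromBlocks M.toBlocks₁₁ M.toBlocks₁₂ 0 M.toBlocks₂₂ := by
  have : M.toBlocks₂₁ = 0 := by ext i j; exact h i j
  rw [← this, Matrix.fromBlocks_toBlocks]

theorem mul_sub_smul_mul_eq_fromBlocks {ι κ κ₁ κ₂ κ₃ ρ₁ ρ₂ ρ₃ : Type*} [Fintype ι] [Fintype κ]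
    {Q : Matrix (ρ₁ ⊕ ρ₂ ⊕ ρ₃) ι ℂ} {Z : Matrix κ (κ₁ ⊕ κ₂ ⊕ κ₃) ℂ} {A E : Matrix ι κ ℂ}
    {A₁₁ E₁₁ : Matrix ρ₁ κ₁ ℂ} {A₁ E₁ : Matrix ρ₁ (κ₂ ⊕ κ₃) ℂ} {A₂₂ E₂₂ : Matrix ρ₂ κ₂ ℂ}
    {A₂ E₂ : Matrix ρ₂ κ₃ ℂ} {A₃ E₃ : Matrix ρ₃ κ₃ ℂ}
    (hA : Q * A * Z = Matrix.fromBlocks A₁₁ A₁ 0 (Matrix.fromBlocks A₂₂ A₂ 0 A₃))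
    (hE : Q * E * Z = Matrix.fromBlocks E₁₁ E₁ 0 (Matrix.fromBlocks E₂₂ E₂ 0 E₃)) (α : ℂ) :
    Q * (A - α • E) * Z = Matrix.fromBlocks (A₁₁ - α • E₁₁) (A₁ - α • E₁) 0
      (Matrix.fromBlocks (A₂₂ - α • E₂₂) (A₂ - α • E₂) 0 (A₃ - α • E₃)) := by
  rw [Matrix.mul_sub, Matrix.sub_mul, Matrix.mul_smul, Matrix.smul_mul, hA, hE]
  ext i j
  rcases i with i | i | i <;> rcases j with j | j | j <;> simp

theorem mulVec_injective_of_eq_zero {ι κ : Type*} [Fintype κ] {M : Matrix ι κ ℂ}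
    (h : ∀ x, M.mulVec x = 0 → x = 0) : Function.Injective M.mulVec :=
  LinearMap.ker_eq_bot.1 (Matrix.ker_mulVecLin_eq_bot_iff.2 h)

/-- Unitary transformation of `A - λ E` and `C` to a block triangular form that separates the right
Kronecker structure, the finite structure and the remaining structure of the restriction of
`A - λ E` to the kernel of `C`. -/
theorem exists_unitary_decomposition {ι κ : Type} {μ : Type*} [Fintype ι] [Fintype κ]
    [DecidableEq ι] [DecidableEq κ] (A E : Matrix ι κ ℂ) (C : Matrix μ κ ℂ) :
    ∃ (ρ₁ ν ρ₃ c₁ c₃ c₄ : ℕ)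
      (Q : Matrix ι (Fin ρ₁ ⊕ Fin ν ⊕ Fin ρ₃) ℂ)
      (Z : Matrix κ (Fin c₁ ⊕ Fin ν ⊕ Fin c₃ ⊕ Fin c₄) ℂ)
      (A₁₁ E₁₁ : Matrix (Fin ρ₁) (Fin c₁) ℂ) (A₁ E₁ : Matrix (Fin ρ₁) (Fin ν ⊕ Fin c₃ ⊕ Fin c₄) ℂ)
      (A₂₂ E₂₂ : Matrix (Fin ν) (Fin ν) ℂ) (A₂ E₂ : Matrix (Fin ν) (Fin c₃ ⊕ Fin c₄) ℂ)
      (A₃ E₃ : Matrix (Fin ρ₃) (Fin c₃ ⊕ Fin c₄) ℂ) (C₄ : Matrix μ (Fin c₄) ℂ),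
      IsUnitary Q ∧ IsUnitary Z ∧
      Qᴴ * A * Z = Matrix.fromBlocks A₁₁ A₁ 0 (Matrix.fromBlocks A₂₂ A₂ 0 A₃) ∧
      Qᴴ * E * Z = Matrix.fromBlocks E₁₁ E₁ 0 (Matrix.fromBlocks E₂₂ E₂ 0 E₃) ∧
      C * Z = Matrix.fromCols 0 (Matrix.fromCols 0 (Matrix.fromCols 0 C₄)) ∧
      (∀ α : ℂ, Function.Surjective (A₁₁ - α • E₁₁).mulVec) ∧ Function.Surjective E₁₁.mulVec ∧
      IsUnit E₂₂ ∧
      (∀ α : ℂ, Function.Injective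
        (Matrix.fromRows (A₃ - α • E₃) (Matrix.fromCols 0 C₄)).mulVec) ∧
      Function.Injective C₄.mulVec := by
  obtain ⟨W, V, hWV, hVS, hAW, hAV, hW, hV, hS⟩ :=
    exists_reducing_subspaces A.mulVecLin E.mulVecLin (LinearMap.ker C.mulVecLin)
  obtain ⟨c₁, ν, c₃, c₄, Z, hZ, hZW, hZV, hZS⟩ := exists_isUnitary_flag_three hWV hVS
  obtain ⟨ρ₁, ν', ρ₃, Q, hQ, hQW, hQV⟩ :=
    exists_isUnitary_flag_two (Submodule.map_mono hWV : W.map E.mulVecLin ≤ V.map E.mulVecLin)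
  have hQMZ : ∀ (M : Matrix ι κ ℂ) y, Q.mulVec ((Qᴴ * M * Z).mulVec y) = M.mulVec (Z.mulVec y) := by
    intro M y
    rw [Matrix.mulVec_mulVec, Matrix.mulVec_mulVec, ← Matrix.mul_assoc, ← Matrix.mul_assoc, hQ.2,
      Matrix.one_mul]
  have hcol : ∀ {α β : Type} [Fintype β] [DecidableEq β] (M : Matrix α β ℂ) i j,
      M.mulVec (Pi.single j 1) i = M i j := by
    intro α β _ _ M i j
    rw [Matrix.mulVec_single_one]; rfl
  -- the zero blocks
  have hblock : ∀ M : Matrix ι κ ℂ, (∀ x ∈ W, M.mulVec x ∈ W.map E.mulVecLin) →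
      (∀ x ∈ V, M.mulVec x ∈ V.map E.mulVecLin) →
      ∃ M₁₁ M₁ M₂₂ M₂ M₃, Qᴴ * M * Z =
        Matrix.fromBlocks M₁₁ M₁ 0 (Matrix.fromBlocks M₂₂ M₂ 0 M₃) := by
    intro M h1 h2
    refine ⟨_, _, _, _, _, (eq_fromBlocks_of_col_eq_zero fun i j => ?_).trans
      (congrArg _ (eq_fromBlocks_of_col_eq_zero fun i j => ?_))⟩
    · refine (hcol (Qᴴ * M * Z) _ _).symm.trans ?_
      refine (hQW _).1 ?_ i
      rw [hQMZ]
      exact h1 _ ((hZW _).2 fun k => by simp)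
    · change (Qᴴ * M * Z) (Sum.inr (Sum.inr i)) (Sum.inr (Sum.inl j)) = 0
      refine (hcol (Qᴴ * M * Z) _ _).symm.trans ?_
      refine (hQV _).1 ?_ i
      rw [hQMZ]
      exact h2 _ ((hZV _).2 fun k => by simp)
  obtain ⟨A₁₁, A₁, A₂₂, A₂, A₃, hA⟩ := hblock A hAW hAV
  obtain ⟨E₁₁, E₁, E₂₂, E₂, E₃, hE⟩ := hblock E (fun x hx => ⟨x, hx, rfl⟩) (fun x hx => ⟨x, hx, rfl⟩)
  obtain ⟨C₄, hC⟩ : ∃ C₄, C * Z = Matrix.fromCols 0 (Matrix.fromCols 0 (Matrix.fromCols 0 C₄)) := by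
    refine ⟨(C * Z).toCols₂.toCols₂.toCols₂, ?_⟩
    have h1 : ∀ j, (∀ k, (Pi.single j (1 : ℂ) : Fin c₁ ⊕ Fin ν ⊕ Fin c₃ ⊕ Fin c₄ → ℂ)
        (Sum.inr (Sum.inr (Sum.inr k))) = 0) → ∀ i, (C * Z) i j = 0 := by
      intro j hj i
      have h2 := (hZS _).2 hj
      rw [LinearMap.mem_ker, Matrix.mulVecLin_apply, Matrix.mulVec_mulVec,
        Matrix.mulVec_single_one] at h2
      exact congrFun h2 i
    ext i j
    rcases j with j | j | j | j
    · exact h1 _ (by simp) i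
    · exact h1 _ (by simp) i
    · exact h1 _ (by simp) i
    · rfl
  have hAE := mul_sub_smul_mul_eq_fromBlocks hA hE
  have hZsurj : ∀ x, ∃ y, Z.mulVec y = x := fun x =>
    ⟨Zᴴ.mulVec x, by rw [Matrix.mulVec_mulVec, hZ.2, Matrix.one_mulVec]⟩
  have hQinj : ∀ x y, Q.mulVec x = Q.mulVec y → x = y := fun x y h => by
    have := congrArg Qᴴ.mulVec h
    simpa [Matrix.mulVec_mulVec, hQ.1] using this
  -- the diagonal blocks in coordinates
  have hsurj₁ : ∀ (M : Matrix ι κ ℂ) M₁₁ M₁ M₂, Qᴴ * M * Z = Matrix.fromBlocks M₁₁ M₁ 0 M₂ →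
      (∀ y ∈ W.map E.mulVecLin, ∃ x ∈ W, M.mulVec x = y) → Function.Surjective M₁₁.mulVec := by
    intro M M₁₁ M₁ M₂ hM h y
    obtain ⟨x, hx, hxy⟩ := h (Q.mulVec (Sum.elim y 0)) ((hQW _).2 (by simp))
    obtain ⟨z, rfl⟩ := hZsurj x
    have hz : z ∘ Sum.inr = 0 := funext ((hZW z).1 hx)
    rw [← hQMZ] at hxy
    have h1 := hQinj _ _ hxy
    rw [hM, Matrix.fromBlocks_mulVec, hz] at h1
    refine ⟨z ∘ Sum.inl, ?_⟩
    have h2 := congrArg (fun u : Fin ρ₁ ⊕ Fin ν' ⊕ Fin ρ₃ → ℂ => u ∘ Sum.inl) h1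
    simpa using h2
  have hE₂₂surj : Function.Surjective E₂₂.mulVec := by
    intro y
    obtain ⟨x, hx, hxy⟩ := (hQV (Sum.elim 0 (Sum.elim y 0))).2 (by simp)
    obtain ⟨z, rfl⟩ := hZsurj x
    have hz : (z ∘ Sum.inr) ∘ Sum.inr = 0 := funext ((hZV z).1 hx)
    rw [Matrix.mulVecLin_apply, ← hQMZ] at hxy
    have h1 := hQinj _ _ hxy
    rw [hE, Matrix.fromBlocks_mulVec, Matrix.fromBlocks_mulVec, hz] at h1
    refine ⟨(z ∘ Sum.inr) ∘ Sum.inl, ?_⟩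
    have h2 := congrArg (fun u : Fin ρ₁ ⊕ Fin ν' ⊕ Fin ρ₃ → ℂ => (u ∘ Sum.inr) ∘ Sum.inl) h1
    simpa using h2
  have hE₂₂inj : Function.Injective E₂₂.mulVec := by
    refine mulVec_injective_of_eq_zero fun x hx => ?_
    have h1 := hV (Z.mulVec (Sum.elim 0 (Sum.elim x 0))) ((hZV _).2 (by simp)) (by
      rw [Matrix.mulVecLin_apply, ← hQMZ, hQW, hE, Matrix.fromBlocks_mulVec,
        Matrix.fromBlocks_mulVec]
      intro j
      rcases j with j | j <;> simp [hx])
    rw [hZW] at h1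
    exact funext fun j => h1 (Sum.inl j)
  obtain rfl : ν' = ν := by
    have := (LinearEquiv.ofBijective E₂₂.mulVecLin ⟨hE₂₂inj, hE₂₂surj⟩).finrank_eq
    simpa using this.symm
  refine ⟨ρ₁, ν', ρ₃, c₁, c₃, c₄, Q, Z, A₁₁, E₁₁, A₁, E₁, A₂₂, E₂₂, A₂, E₂, A₃, E₃, C₄, hQ, hZ, hA, hE,
    hC, fun α => ?_, ?_, Matrix.mulVec_injective_iff_isUnit.1 hE₂₂inj, fun α => ?_, ?_⟩
  · refine hsurj₁ (A - α • E) _ _ _ (hAE α) fun y hy => ?_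
    obtain ⟨x, hx, hxy⟩ := hW α y hy
    refine ⟨x, hx, ?_⟩
    rw [Matrix.sub_mulVec, Matrix.smul_mulVec]
    exact hxy
  · refine hsurj₁ E _ _ _ hE fun y hy => ?_
    obtain ⟨x, hx, hxy⟩ := hy
    exact ⟨x, hx, hxy⟩
  · refine mulVec_injective_of_eq_zero fun x h0 => ?_
    rw [Matrix.fromRows_mulVec] at h0
    have h3 : (A₃ - α • E₃).mulVec x = 0 := funext fun i => congrFun h0 (Sum.inl i)
    have h4 : (Matrix.fromCols 0 C₄).mulVec x = 0 := funext fun i => congrFun h0 (Sum.inr i)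
    have h1 := hS α (Z.mulVec (Sum.elim 0 (Sum.elim 0 x))) (by
      rw [LinearMap.mem_ker, Matrix.mulVecLin_apply, Matrix.mulVec_mulVec, hC,
        Matrix.fromCols_mulVec_sumElim, Matrix.fromCols_mulVec_sumElim, h4]
      simp) (by
      have : A.mulVecLin (Z.mulVec (Sum.elim 0 (Sum.elim 0 x))) -
          α • E.mulVecLin (Z.mulVec (Sum.elim 0 (Sum.elim 0 x))) =
          (A - α • E).mulVec (Z.mulVec (Sum.elim 0 (Sum.elim 0 x))) := by
        rw [Matrix.sub_mulVec, Matrix.smul_mulVec]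
        rfl
      rw [this, ← hQMZ, hQV, hAE, Matrix.fromBlocks_mulVec, Matrix.fromBlocks_mulVec]
      intro j
      simpa using congrFun h3 j)
    rw [hZV] at h1
    exact funext h1
  · refine mulVec_injective_of_eq_zero fun x h0 => ?_
    have h1 := (hZS (Sum.elim 0 (Sum.elim 0 (Sum.elim 0 x)))).1 (by
      rw [LinearMap.mem_ker, Matrix.mulVecLin_apply, Matrix.mulVec_mulVec, hC,
        Matrix.fromCols_mulVec_sumElim, Matrix.fromCols_mulVec_sumElim,
        Matrix.fromCols_mulVec_sumElim, h0]
      simp)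
    exact funext h1

end Decomposition

/-! ### The system matrix -/

section SystemMatrix

/-- The constant part of the first `d` block rows of the state pencil. -/
def shiftConst (d n : ℕ) : Matrix (Fin d × Fin n) (Fin (d + 1) × Fin n) ℂ :=
  Matrix.of fun i j => if j = (i.1.castSucc, i.2) then 1 else 0

/-- The matrix `E` in the form `A - λ E` of the first `d` block rows of the state pencil. -/
def shiftLin (d n : ℕ) : Matrix (Fin d × Fin n) (Fin (d + 1) × Fin n) ℂ :=
  Matrix.of fun i j => if j = (i.1.succ, i.2) then 1 else 0

/-- The last block row of the state pencil as a constant matrix. -/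
def lastConst (d n : ℕ) : Matrix (Fin n) (Fin (d + 1) × Fin n) ℂ :=
  Matrix.of fun i j => if j = (Fin.last d, i) then 1 else 0

/-- The coefficients of a polynomial matrix as a constant matrix. -/
noncomputable def coeffConst {m n : ℕ} (d : ℕ) (P : Matrix (Fin m) (Fin n) ℂ[X]) :
    Matrix (Fin m) (Fin (d + 1) × Fin n) ℂ :=
  Matrix.of fun i j => (P i j.2).coeff (Fin.rev j.1)

theorem shiftRows_eq_pencil (d n : ℕ) : shiftRows d n = pencil (shiftConst d n) (shiftLin d n) := by
  ext1 ⟨i, a⟩ ⟨j, b⟩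
  rw [pencil_apply]
  by_cases hab : a = b
  · subst hab
    by_cases hj : j = i.castSucc
    · simp [shiftRows, shiftConst, shiftLin, hj, (Fin.castSucc_lt_succ (i := i)).ne]
    · by_cases hj' : j = i.succ <;> simp [shiftRows, shiftConst, shiftLin, hj, hj',
        (Fin.castSucc_lt_succ (i := i)).ne']
  · simp [shiftRows, shiftConst, shiftLin, hab, Ne.symm hab]

theorem lastRow_eq_const (d n : ℕ) : lastRow d n = const (lastConst d n) := by
  ext1 i j
  simp [lastRow, lastConst, const_apply, apply_ite Polynomial.C]

theorem coeffRow_eq_const {m n : ℕ} (d : ℕ) (P : Matrix (Fin m) (Fin n) ℂ[X]) :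
    coeffRow d P = const (coeffConst d P) := rfl

theorem shiftRows_mul {d n : ℕ} {κ : Type*} (M : Matrix (Fin (d + 1) × Fin n) κ ℂ[X])
    (i : Fin d × Fin n) (k : κ) :
    (shiftRows d n * M) i k = M (i.1.castSucc, i.2) k - Polynomial.X * M (i.1.succ, i.2) k := by
  rw [shiftRows_eq_pencil, Matrix.mul_apply]
  simp [pencil_apply, sub_mul, Finset.sum_sub_distrib, shiftConst, shiftLin, apply_ite Polynomial.C]

theorem lastRow_mul {d n : ℕ} {κ : Type*} (M : Matrix (Fin (d + 1) × Fin n) κ ℂ[X])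
    (i : Fin n) (k : κ) : (lastRow d n * M) i k = M (Fin.last d, i) k := by
  simp [lastRow, Matrix.mul_apply]

/-- The block rows of the state pencil, identified with the block columns. -/
noncomputable def rowEquiv (d n : ℕ) : (Fin d × Fin n) ⊕ Fin n ≃ Fin (d + 1) × Fin n :=
  Equiv.ofBijective (Sum.elim (fun p => (p.1.castSucc, p.2)) fun a => (Fin.last d, a)) <| by
    constructor
    · rintro (⟨i, a⟩ | a) (⟨j, b⟩ | b) h
      · simpa using h
      · simp [(Fin.castSucc_lt_last i).ne] at h
      · simp [(Fin.castSucc_lt_last j).ne'] at h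
      · simpa using h
    · rintro ⟨i, a⟩
      refine Fin.lastCases ⟨Sum.inr a, rfl⟩ (fun i => ⟨Sum.inl (i, a), rfl⟩) i

/-- The inverse of the state pencil: the upper triangular block Toeplitz matrix with blocks
`λ ^ (j - i) I_n`. -/
noncomputable def powers (d n : ℕ) : Matrix (Fin (d + 1) × Fin n) (Fin (d + 1) × Fin n) ℂ[X] :=
  Matrix.of fun i j =>
    if i.2 = j.2 ∧ i.1 ≤ j.1 then Polynomial.X ^ (j.1.val - i.1.val) else 0

theorem statePencil_mul_powers (d n : ℕ) :
    Matrix.fromRows (shiftRows d n) (lastRow d n) * powers d n =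
      (1 : Matrix (Fin (d + 1) × Fin n) (Fin (d + 1) × Fin n) ℂ[X]).submatrix
        (rowEquiv d n) (Equiv.refl _) := by
  ext1 i ⟨j, b⟩
  rw [Matrix.fromRows_mul]
  rcases i with ⟨i, a⟩ | a
  · rw [Matrix.fromRows_apply_inl, shiftRows_mul]
    have h0 : rowEquiv d n (Sum.inl (i, a)) = (i.castSucc, a) := rfl
    simp only [powers, Matrix.of_apply, Matrix.submatrix_apply, h0, Equiv.refl_apply,
      Matrix.one_apply, Prod.mk.injEq]
    by_cases hab : a = b
    · rcases lt_trichotomy i.castSucc j with h | h | h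
      · have h1 : i.succ ≤ j := Fin.castSucc_lt_iff_succ_le.1 h
        have h2 : j.val - i.val = (j.val - (i.val + 1)) + 1 := by
          have := Fin.lt_def.1 h
          simp at this
          omega
        simp [hab, h.le, h1, h.ne, h2, pow_succ']
      · subst h
        have h1 : ¬ i.succ ≤ i.castSucc := by simp
        simp [hab, h1]
      · have h1 : ¬ i.succ ≤ j := fun h' => absurd (Fin.castSucc_lt_succ.trans_le h') h.asymm
        simp [hab, h.not_ge, h1, h.ne']
    · simp [hab]
  · rw [Matrix.fromRows_apply_inr, lastRow_mul]
    have h0 : rowEquiv d n (Sum.inr a) = (Fin.last d, a) := rfl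
    simp only [powers, Matrix.of_apply, Matrix.submatrix_apply, h0, Equiv.refl_apply,
      Matrix.one_apply, Prod.mk.injEq, Fin.last_le_iff]
    by_cases hab : a = b <;> by_cases hj : j = Fin.last d <;>
      simp [hab, hj, eq_comm (a := Fin.last d)]

theorem isUnimodular_powers (d n : ℕ) : IsUnimodular (powers d n) := by
  have h := congrArg (fun M => M.submatrix (rowEquiv d n).symm (Equiv.refl _))
    (statePencil_mul_powers d n)
  have h1 : (Matrix.fromRows (shiftRows d n) (lastRow d n)).submatrix (rowEquiv d n).symm id *
      powers d n = 1 := by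
    refine Eq.trans ?_ (h.trans ?_)
    · ext1 i j; rfl
    · ext1 i j; simp [Matrix.one_apply]
  exact ⟨_, mul_eq_one_comm.1 h1, h1⟩

theorem shiftRows_mul_powers (d n : ℕ) (i : Fin d × Fin n) (j : (Fin d × Fin n) ⊕ Fin n) :
    (shiftRows d n * powers d n) i (rowEquiv d n j) =
      (Matrix.fromCols 1 0 : Matrix (Fin d × Fin n) ((Fin d × Fin n) ⊕ Fin n) ℂ[X]) i j := by
  have h := congrFun (congrFun (statePencil_mul_powers d n) (Sum.inl i)) (rowEquiv d n j)
  rw [Matrix.fromRows_mul, Matrix.fromRows_apply_inl] at h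
  rw [h]
  rcases j with j | j <;> simp [Matrix.one_apply]

theorem coeffRow_mul_powers {m n d : ℕ} (P : Matrix (Fin m) (Fin n) ℂ[X])
    (hd : ∀ i j, (P i j).natDegree ≤ d) (i : Fin m) (b : Fin n) :
    (coeffRow d P * powers d n) i (Fin.last d, b) = P i b := by
  rw [Matrix.mul_apply, Fintype.sum_prod_type]
  conv_rhs => rw [(P i b).as_sum_range' (d + 1) (Nat.lt_succ_of_le (hd i b)), Finset.sum_range]
  rw [← Equiv.sum_comp Fin.revPerm]
  refine Finset.sum_congr rfl fun j _ => ?_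
  rw [Finset.sum_eq_single b]
  · have : d - (d - j.val) = j.val := by omega
    simp [coeffRow, powers, Fin.le_last, ← Polynomial.C_mul_X_pow_eq_monomial, Fin.val_rev, this]
  · intro a _ hab
    simp [powers, hab]
  · simp

/-- The state pencil without its last block row, together with the output matrix, is equivalent to
`diag(I, P)`. -/
theorem unimodEquiv_shiftRows_coeffRow {m n d : ℕ} (P : Matrix (Fin m) (Fin n) ℂ[X])
    (hd : ∀ i j, (P i j).natDegree ≤ d) :
    UnimodEquiv (Matrix.fromRows (shiftRows d n) (coeffRow d P))
      (Matrix.fromBlocks (1 : Matrix (Fin d × Fin n) (Fin d × Fin n) ℂ[X]) 0 0 P) := by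
  obtain ⟨L, hL⟩ : ∃ L, (Matrix.fromRows (shiftRows d n) (coeffRow d P) * powers d n).submatrix
      (Equiv.refl _) (rowEquiv d n) =
        Matrix.fromBlocks (1 : Matrix (Fin d × Fin n) (Fin d × Fin n) ℂ[X]) 0 L P := by
    refine ⟨Matrix.of fun i j => (coeffRow d P * powers d n) i (rowEquiv d n (Sum.inl j)), ?_⟩
    rw [Matrix.fromRows_mul]
    ext1 i j
    rcases i with i | i
    · refine (shiftRows_mul_powers d n i j).trans ?_
      rcases j with j | j <;> simp
    · rcases j with j | j
      · rfl
      · exact coeffRow_mul_powers P hd i j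
  have h1 := (UnimodEquiv.mul_right (Matrix.fromRows (shiftRows d n) (coeffRow d P))
    (isUnimodular_powers d n)).trans (.submatrix _ (Equiv.refl _) (rowEquiv d n))
  rw [hL] at h1
  have h2 := h1.trans (.mul_left (IsUnimodular.one.fromBlocks_lower (-L) .one) _)
  rw [Matrix.fromBlocks_multiply] at h2
  simpa using h2

theorem shiftConst_sub_surjective (d n : ℕ) (α : ℂ) :
    Function.Surjective (shiftConst d n - α • shiftLin d n).mulVec := by
  obtain ⟨V, hV⟩ : ∃ V : Matrix (Fin (d + 1) × Fin n) (Fin d × Fin n) ℂ[X], shiftRows d n * V = 1 := by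
    refine ⟨(powers d n).submatrix id (fun i => rowEquiv d n (Sum.inl i)), ?_⟩
    ext1 i j
    exact (shiftRows_mul_powers d n i (Sum.inl j)).trans (by simp)
  rw [Matrix.mulVec_surjective_iff_exists_right_inverse]
  refine ⟨V.map (Polynomial.eval α), ?_⟩
  have := congrArg (fun M => M.map (Polynomial.evalRingHom α)) hV
  simp only [Matrix.map_mul, shiftRows_eq_pencil] at this
  rw [← pencil_map_eval]
  refine this.trans ?_
  simp

theorem shiftLin_surjective (d n : ℕ) : Function.Surjective (shiftLin d n).mulVec := by
  intro y
  refine ⟨fun j => Fin.cases 0 (fun i => y (i, j.2)) j.1, ?_⟩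
  ext i
  simp [Matrix.mulVec, dotProduct, shiftLin]

theorem transformed_eq {m n d : ℕ} (P : Matrix (Fin m) (Fin n) ℂ[X])
    {ι κ : Type*} [Fintype κ]
    (Q : Matrix (Fin d × Fin n) ι ℂ) (Z : Matrix (Fin (d + 1) × Fin n) κ ℂ)
    (F : Matrix (Fin n) (Fin (d + 1) × Fin n) ℂ) :
    transformed d P Q Z F = Matrix.fromBlocks
      (Matrix.fromRows (pencil (Qᴴ * shiftConst d n * Z) (Qᴴ * shiftLin d n * Z))
        (const ((lastConst d n - F) * Z)))
      (Matrix.fromRows 0 (-1)) (const (coeffConst d P * Z)) 0 := by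
  rw [transformed, systemMatrix, Matrix.fromBlocks_multiply, Matrix.fromBlocks_multiply,
    Matrix.fromBlocks_mul_fromRows, Matrix.fromBlocks_mul_fromRows]
  rw [shiftRows_eq_pencil, lastRow_eq_const, coeffRow_eq_const]
  simp only [Matrix.zero_mul, Matrix.mul_zero, add_zero, zero_add, Matrix.one_mul, Matrix.mul_one,
    Matrix.fromRows_mul, const_mul_pencil, pencil_mul_const, ← const_mul, Matrix.sub_mul, const_sub]
  congr 1
  ext1 i j
  rcases i with i | i <;> simp [sub_eq_add_neg]

end SystemMatrix

/-! ### Assembling the decomposition -/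

section Assembly

theorem rank_eq_of_left_inverse {ι κ : Type*} [Fintype ι] [Fintype κ] [DecidableEq κ]
    {R : Matrix ι κ ℂ} {B : Matrix κ ι ℂ} (h : B * R = 1) : R.rank = Fintype.card κ := by
  refine le_antisymm R.rank_le_card_width ?_
  calc Fintype.card κ = (B * R).rank := by rw [h, Matrix.rank_one]
    _ ≤ R.rank := Matrix.rank_mul_le_right _ _

theorem rank_eq_of_mulVec_injective {ι κ : Type*} [Fintype κ] {M : Matrix ι κ ℂ}
    (h : Function.Injective M.mulVec) : M.rank = Fintype.card κ := by
  have := LinearMap.finrank_range_of_inj (f := M.mulVecLin) h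
  rwa [Module.finrank_fintype_fun_eq_card] at this

theorem rank_eq_of_mulVec_surjective {ι κ : Type*} [Fintype ι] [Fintype κ] {M : Matrix ι κ ℂ}
    (h : Function.Surjective M.mulVec) : M.rank = Fintype.card ι := by
  have : LinearMap.range M.mulVecLin = ⊤ := LinearMap.range_eq_top.2 h
  rw [Matrix.rank, this, finrank_top, Module.finrank_fintype_fun_eq_card]

/-- A subpencil is unobservable as soon as the coefficient matrices of the pencils satisfy the
intertwining relations. -/
theorem isUnobservable_pencil {ι κ μ α β : Type*} [Fintype ι] [Fintype κ] [Fintype α]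
    [Fintype β] [DecidableEq α] [DecidableEq β] {TA TE : Matrix ι κ ℂ} {C : Matrix μ κ ℂ}
    {HA HE : Matrix α β ℂ} (R : Matrix κ β ℂ) (L : Matrix ι α ℂ) (R' : Matrix β κ ℂ)
    (L' : Matrix α ι ℂ) (hcard : Fintype.card α = Fintype.card β) (hR : R' * R = 1)
    (hL : L' * L = 1) (hA : TA * R = L * HA) (hE : TE * R = L * HE) (hC : C * R = 0) :
    IsUnobservable (pencil TA TE) (const C) (pencil HA HE) :=
  ⟨hcard, R, L, rank_eq_of_left_inverse hR, rank_eq_of_left_inverse hL, by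
    rw [pencil_mul_const, const_mul_pencil, hA, hE], by rw [← const_mul, hC, const_zero]⟩

/-- Suppose that `M` is equivalent to `diag(I, P)` and to a block triangular matrix with a right
Kronecker block, a block `A₂₂ - λ E₂₂` with `E₂₂` invertible, and a block of full column rank at every
point on the diagonal. Diagonalizing further, both become Smith forms up to the order of the diagonal
entries; by uniqueness the second block has the zeros of `P`, and the numbers of nonzero entries
agree. -/
theorem finiteZeros_of_decomposition {m n : ℕ} {δ ι κ : Type} [Fintype δ] [DecidableEq δ]
    [Fintype ι] [DecidableEq ι] [Fintype κ] [DecidableEq κ]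
    {ρ₁ ν c₁ w : ℕ} {σ : Type} [Fintype σ] [DecidableEq σ] {P : Matrix (Fin m) (Fin n) ℂ[X]}
    {M : Matrix (δ ⊕ Fin m) κ ℂ[X]}
    (hM : UnimodEquiv M (Matrix.fromBlocks (1 : Matrix δ δ ℂ[X]) 0 0 P))
    {A₁₁ E₁₁ : Matrix (Fin ρ₁) (Fin c₁) ℂ} {Z₁ : Matrix (Fin w) (Fin c₁) ℂ}
    (h₁ : IsUnimodular (Matrix.fromRows (pencil A₁₁ E₁₁) (const Z₁)))
    {A₂₂ E₂₂ : Matrix (Fin ν) (Fin ν) ℂ} (h₂ : IsUnit E₂₂)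
    {D : Matrix ι σ ℂ[X]} (h₃ : ∀ α : ℂ, Function.Injective (D.map (Polynomial.eval α)).mulVec)
    {B₁ : Matrix (Fin ρ₁) (Fin ν ⊕ σ) ℂ[X]} {B₂ : Matrix (Fin ν) σ ℂ[X]}
    (hB : UnimodEquiv M (Matrix.fromBlocks (pencil A₁₁ E₁₁) B₁ 0
      (Matrix.fromBlocks (pencil A₂₂ E₂₂) B₂ 0 D))) :
    Fintype.card δ + normalRank P = ρ₁ + Fintype.card σ + ν ∧
      SameFiniteZeros (pencil A₂₂ E₂₂) P := by
  obtain ⟨hA, A', hA'⟩ := h₁.upper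
  obtain ⟨a, hD⟩ := unimodEquiv_of_injective h₃
  obtain ⟨D', hD'⟩ := hD.exists_left_inverse
  obtain ⟨k, a₁, b₁, s, hs, hPs⟩ := exists_smithMatrix P
  obtain ⟨k', a₂, b₂, t, ht, hAt⟩ := exists_smithMatrix (pencil A₂₂ E₂₂)
  have hk := normalRank_eq_of_unimodEquiv hs hPs
  have hk' := (normalRank_eq_of_unimodEquiv ht hAt).symm.trans (normalRank_pencil A₂₂ h₂)
  have hdiag := ((hB.trans (.clear_right hA' _ _)).trans
    (UnimodEquiv.fromBlocks (.refl _) (.clear_above hD' _ _))).trans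
    (hA.fromBlocks (hAt.fromBlocks hD))
  have h := ((UnimodEquiv.fromBlocks (.refl (1 : Matrix δ δ ℂ[X])) hPs).symm.trans
    (hM.symm.trans hdiag)).trans (unimodEquiv_collect t _ _ _ _)
  obtain ⟨hcard, hst⟩ := nontrivialPart_eq_of_unimodEquiv hs ht h
  refine ⟨?_, k', k, t, s, isSmithForm_of_unimodEquiv ht hAt, isSmithForm_of_unimodEquiv hs hPs,
    hst.symm⟩
  rw [hk]
  simpa [hk'] using hcard

theorem surjective_last_block {ι κ κ₁ κ₂ κ₃ ρ₁ ρ₂ ρ₃ : Type*} [Fintype ι] [Fintype κ] [Fintype κ₁]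
    [Fintype κ₂] [Fintype κ₃] [Fintype ρ₁] [Fintype ρ₂] [Fintype ρ₃] [DecidableEq ι] [DecidableEq κ]
    [DecidableEq κ₁] [DecidableEq κ₂] [DecidableEq κ₃] [DecidableEq ρ₁] [DecidableEq ρ₂]
    [DecidableEq ρ₃] {Q : Matrix ι (ρ₁ ⊕ ρ₂ ⊕ ρ₃) ℂ} {Z : Matrix κ (κ₁ ⊕ κ₂ ⊕ κ₃) ℂ}
    (hQ : IsUnitary Q) (hZ : IsUnitary Z) {M : Matrix ι κ ℂ} (hM : Function.Surjective M.mulVec)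
    {M₁₁ : Matrix ρ₁ κ₁ ℂ} {M₁ : Matrix ρ₁ (κ₂ ⊕ κ₃) ℂ} {M₂₂ : Matrix ρ₂ κ₂ ℂ} {M₂ : Matrix ρ₂ κ₃ ℂ}
    {M₃ : Matrix ρ₃ κ₃ ℂ}
    (h : Qᴴ * M * Z = Matrix.fromBlocks M₁₁ M₁ 0 (Matrix.fromBlocks M₂₂ M₂ 0 M₃)) :
    Function.Surjective M₃.mulVec := by
  intro y
  let u : ρ₁ ⊕ ρ₂ ⊕ ρ₃ → ℂ := Sum.elim 0 (Sum.elim 0 y)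
  obtain ⟨x, hx⟩ := hM (Q.mulVec u)
  have h1 : (Qᴴ * M * Z).mulVec (Zᴴ.mulVec x) = u := by
    rw [Matrix.mulVec_mulVec, Matrix.mul_assoc, hZ.2, Matrix.mul_one, ← Matrix.mulVec_mulVec, hx,
      Matrix.mulVec_mulVec, hQ.1, Matrix.one_mulVec]
  rw [h, Matrix.fromBlocks_mulVec, Matrix.fromBlocks_mulVec] at h1
  refine ⟨(Zᴴ.mulVec x ∘ Sum.inr) ∘ Sum.inr, ?_⟩
  have h2 := congrArg (fun u : ρ₁ ⊕ ρ₂ ⊕ ρ₃ → ℂ => (u ∘ Sum.inr) ∘ Sum.inr) h1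
  simpa [u] using h2

/-- The state pencil without its last block row, together with the output matrix, in the block
triangular form. -/
theorem unimodEquiv_blocks {m n d ρ₁ ν ρ₃ c₁ c₃ c₄ : ℕ} (P : Matrix (Fin m) (Fin n) ℂ[X])
    {Q : Matrix (Fin d × Fin n) (Fin ρ₁ ⊕ Fin ν ⊕ Fin ρ₃) ℂ}
    {Z : Matrix (Fin (d + 1) × Fin n) (Fin c₁ ⊕ Fin ν ⊕ Fin c₃ ⊕ Fin c₄) ℂ}
    (hQ : IsUnitary Q) (hZ : IsUnitary Z)
    {A₁₁ E₁₁ : Matrix (Fin ρ₁) (Fin c₁) ℂ} {A₁ E₁ : Matrix (Fin ρ₁) (Fin ν ⊕ Fin c₃ ⊕ Fin c₄) ℂ}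
    {A₂₂ E₂₂ : Matrix (Fin ν) (Fin ν) ℂ} {A₂ E₂ : Matrix (Fin ν) (Fin c₃ ⊕ Fin c₄) ℂ}
    {A₃ E₃ : Matrix (Fin ρ₃) (Fin c₃ ⊕ Fin c₄) ℂ} {C₄ : Matrix (Fin m) (Fin c₄) ℂ}
    (hA : Qᴴ * shiftConst d n * Z = Matrix.fromBlocks A₁₁ A₁ 0 (Matrix.fromBlocks A₂₂ A₂ 0 A₃))
    (hE : Qᴴ * shiftLin d n * Z = Matrix.fromBlocks E₁₁ E₁ 0 (Matrix.fromBlocks E₂₂ E₂ 0 E₃))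
    (hC : coeffConst d P * Z = Matrix.fromCols 0 (Matrix.fromCols 0 (Matrix.fromCols 0 C₄))) :
    UnimodEquiv (Matrix.fromRows (shiftRows d n) (coeffRow d P))
      (Matrix.fromBlocks (pencil A₁₁ E₁₁) (pencil A₁ E₁) 0
        (Matrix.fromBlocks (pencil A₂₂ E₂₂) (pencil A₂ E₂) 0
          (Matrix.fromRows (pencil A₃ E₃) (const (Matrix.fromCols 0 C₄))))) := by
  have h1 : UnimodEquiv (Matrix.fromRows (shiftRows d n) (coeffRow d P))
      ((Matrix.fromBlocks (const Qᴴ) 0 0 1 :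
        Matrix ((Fin ρ₁ ⊕ Fin ν ⊕ Fin ρ₃) ⊕ Fin m) ((Fin d × Fin n) ⊕ Fin m) ℂ[X]) *
        Matrix.fromRows (shiftRows d n) (coeffRow d P) * const Z) :=
    ⟨_, const Z, (IsUnimodular.const (N := Q) hQ.1 hQ.2).fromBlocks_upper 0 .one,
      .const hZ.2 hZ.1, rfl⟩
  refine h1.trans ?_
  rw [Matrix.fromBlocks_mul_fromRows, Matrix.fromRows_mul]
  simp only [Matrix.zero_mul, add_zero, zero_add, Matrix.one_mul, shiftRows_eq_pencil,
    coeffRow_eq_const, const_mul_pencil, pencil_mul_const, ← const_mul, hA, hE, hC]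
  convert UnimodEquiv.submatrix (Matrix.fromRows
      (pencil (Matrix.fromBlocks A₁₁ A₁ 0 (Matrix.fromBlocks A₂₂ A₂ 0 A₃))
        (Matrix.fromBlocks E₁₁ E₁ 0 (Matrix.fromBlocks E₂₂ E₂ 0 E₃)))
      (const (Matrix.fromCols 0 (Matrix.fromCols 0 (Matrix.fromCols 0 C₄)))))
    ((Equiv.sumCongr (Equiv.refl (Fin ρ₁)) (Equiv.sumAssoc (Fin ν) (Fin ρ₃) (Fin m)).symm).trans
      (Equiv.sumAssoc (Fin ρ₁) (Fin ν ⊕ Fin ρ₃) (Fin m)).symm)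
    (Equiv.refl _) using 1
  ext1 i j
  rcases i with i | i | i | i <;> rcases j with j | j | j | j <;>
    simp [pencil_apply, const_apply]

end Assembly

end PolySys

open PolySys
theorem theorem4p2 (m n d r : ℕ) (P : Matrix (Fin m) (Fin n) ℂ[X])
    (hd : ∀ i j, (P i j).natDegree ≤ d) (hr : normalRank P = r) :
    ∃ (hrn : r ≤ n) (ρ₁ ν ρ₃ c₁ c₃ c₄ : ℕ)
      (A₁₁ E₁₁ : Matrix (Fin ρ₁) (Fin c₁) ℂ) (A₁₂ E₁₂ : Matrix (Fin ρ₁) (Fin ν) ℂ)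
      (A₁₃ E₁₃ : Matrix (Fin ρ₁) (Fin c₃) ℂ) (A₁₄ E₁₄ : Matrix (Fin ρ₁) (Fin c₄) ℂ)
      (A₂₂ E₂₂ : Matrix (Fin ν) (Fin ν) ℂ)
      (A₂₃ E₂₃ : Matrix (Fin ν) (Fin c₃) ℂ) (A₂₄ E₂₄ : Matrix (Fin ν) (Fin c₄) ℂ)
      (A₃₃ E₃₃ : Matrix (Fin ρ₃) (Fin c₃) ℂ) (A₃₄ E₃₄ : Matrix (Fin ρ₃) (Fin c₄) ℂ)
      (C₄ : Matrix (Fin m) (Fin c₄) ℂ)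
      (Z₁ : Matrix (Fin (n - r)) (Fin c₁) ℂ)
      (Z₃ : Matrix (Fin r) (Fin c₃) ℂ) (Z₄ : Matrix (Fin r) (Fin c₄) ℂ)
      (F : Matrix (Fin n) (Fin (d + 1) × Fin n) ℂ)
      (Q : Matrix (Fin d × Fin n) (Fin ρ₁ ⊕ Fin ν ⊕ Fin ρ₃) ℂ)
      (Z : Matrix (Fin (d + 1) × Fin n) (Fin c₁ ⊕ Fin ν ⊕ Fin c₃ ⊕ Fin c₄) ℂ)
      -- the state pencil and the output matrix of the transformed realization
      (T : Matrix ((Fin ρ₁ ⊕ Fin ν ⊕ Fin ρ₃) ⊕ (Fin r ⊕ Fin (n - r)))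
        (Fin c₁ ⊕ Fin ν ⊕ Fin c₃ ⊕ Fin c₄) ℂ[X])
      (K : Matrix (Fin m) (Fin c₁ ⊕ Fin ν ⊕ Fin c₃ ⊕ Fin c₄) ℂ[X]),
      IsUnitary Q ∧ IsUnitary Z ∧
      -- the block form
      T = Matrix.fromRows
        (Matrix.fromRows
          (row4 (pencil A₁₁ E₁₁) (pencil A₁₂ E₁₂) (pencil A₁₃ E₁₃) (pencil A₁₄ E₁₄))
          (Matrix.fromRows
            (row4 0 (pencil A₂₂ E₂₂) (pencil A₂₃ E₂₃) (pencil A₂₄ E₂₄))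
            (row4 0 0 (pencil A₃₃ E₃₃) (pencil A₃₄ E₃₄))))
        (Matrix.fromRows
          (row4 0 0 (const Z₃) (const Z₄))
          (row4 (const Z₁) 0 0 0)) ∧
      K = row4 0 0 0 (const C₄) ∧
      (transformed d P Q Z F).submatrix (Sum.map (Sum.map id (split hrn)) id)
          (Sum.map id (split hrn)) =
        Matrix.fromBlocks
          T (Matrix.fromRows 0 (Matrix.fromBlocks (-1) 0 0 (-1)))
          K 0 ∧
      -- the block (2,2): exactly the finite zeros of `P`, no infinite ones, unobservable
      SameFiniteZeros (pencil A₂₂ E₂₂) P ∧ IsUnit E₂₂ ∧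
      IsUnobservable T K (pencil A₂₂ E₂₂) ∧
      -- the block (1,1): only right Kronecker blocks; unimodular with `Z₁`, unobservable
      (∀ α : ℂ, (A₁₁ - α • E₁₁).rank = ρ₁) ∧ E₁₁.rank = ρ₁ ∧
      IsUnimodular (Matrix.fromRows (pencil A₁₁ E₁₁) (const Z₁)) ∧
      IsUnobservable T K (Matrix.fromRows (pencil A₁₁ E₁₁) (const Z₁)) ∧
      -- the remaining block: no right Kronecker blocks and no finite zeros
      (∀ α : ℂ, (Matrix.fromBlocks (A₃₃ - α • E₃₃) (A₃₄ - α • E₃₄) 0 C₄).rank = c₃ + c₄) ∧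
      C₄.rank = c₄ ∧
      -- the unimodular embedding
      IsUnimodular (Matrix.fromBlocks (pencil A₃₃ E₃₃) (pencil A₃₄ E₃₄)
        (const Z₃) (const Z₄)) := by
  obtain ⟨ρ₁, ν, ρ₃, c₁, c₃, c₄, Q, Z, A₁₁, E₁₁, A₁, E₁, A₂₂, E₂₂, A₂, E₂, A₃, E₃, C₄, hQ, hZ, hA, hE, hC,
    hA₁₁, hE₁₁, hE₂₂, hinj, hC₄⟩ :=
    exists_unitary_decomposition (shiftConst d n) (shiftLin d n) (coeffConst d P)
  obtain ⟨w₁, Z₁, hU₁⟩ := exists_unimodular_completion ρ₁ A₁₁ E₁₁ hA₁₁ hE₁₁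
  -- the last diagonal block inherits full row rank from the state pencil
  obtain ⟨w₃, Z₃₄, hU₃⟩ := exists_unimodular_completion ρ₃ A₃ E₃
    (fun α => surjective_last_block hQ hZ (shiftConst_sub_surjective d n α) 
      (mul_sub_smul_mul_eq_fromBlocks hA hE α))
    (surjective_last_block hQ hZ (shiftLin_surjective d n) hE)
  -- the zeros, and the numbers of the completing rows
  obtain ⟨hcount, hzeros⟩ := finiteZeros_of_decomposition (unimodEquiv_shiftRows_coeffRow P hd) hU₁
    hE₂₂ (D := Matrix.fromRows (pencil A₃ E₃) (const (Matrix.fromCols 0 C₄)))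
    (fun α => by
      have h1 : (Matrix.fromRows (pencil A₃ E₃) (const (Matrix.fromCols 0 C₄))).map
          (Polynomial.eval α) = Matrix.fromRows (A₃ - α • E₃) (Matrix.fromCols 0 C₄) := by
        rw [Matrix.fromRows_map, pencil_map_eval]
        congr 1
        ext i j
        simp [const_apply]
      rw [h1]
      exact hinj α)
    (unimodEquiv_blocks P hQ hZ hA hE hC)
  have hcardQ := hQ.card_eq
  have hcardZ := hZ.card_eq
  have hcard₁ := hU₁.card_eq
  have hcard₃ := hU₃.card_eq
  simp only [Fintype.card_sum, Fintype.card_prod, Fintype.card_fin, add_mul, one_mul]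
    at hcardQ hcardZ hcard₁ hcard₃ hcount
  rw [hr] at hcount
  have hrn : r ≤ n := by omega
  obtain rfl : w₃ = r := by omega
  obtain rfl : w₁ = n - w₃ := by omega
  obtain ⟨A₁₂, A₁₃, A₁₄, rfl⟩ : ∃ X Y W, A₁ = Matrix.fromCols X (Matrix.fromCols Y W) :=
    ⟨_, _, _, by rw [Matrix.fromCols_toCols, Matrix.fromCols_toCols]⟩
  obtain ⟨E₁₂, E₁₃, E₁₄, rfl⟩ : ∃ X Y W, E₁ = Matrix.fromCols X (Matrix.fromCols Y W) :=
    ⟨_, _, _, by rw [Matrix.fromCols_toCols, Matrix.fromCols_toCols]⟩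
  obtain ⟨A₂₃, A₂₄, rfl⟩ : ∃ X Y, A₂ = Matrix.fromCols X Y := ⟨_, _, (Matrix.fromCols_toCols _).symm⟩
  obtain ⟨E₂₃, E₂₄, rfl⟩ : ∃ X Y, E₂ = Matrix.fromCols X Y := ⟨_, _, (Matrix.fromCols_toCols _).symm⟩
  obtain ⟨A₃₃, A₃₄, rfl⟩ : ∃ X Y, A₃ = Matrix.fromCols X Y := ⟨_, _, (Matrix.fromCols_toCols _).symm⟩
  obtain ⟨E₃₃, E₃₄, rfl⟩ : ∃ X Y, E₃ = Matrix.fromCols X Y := ⟨_, _, (Matrix.fromCols_toCols _).symm⟩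
  obtain ⟨Z₃, Z₄, rfl⟩ : ∃ X Y, Z₃₄ = Matrix.fromCols X Y := ⟨_, _, (Matrix.fromCols_toCols _).symm⟩
  -- the feedback replaces the last block row by the completing rows
  let G : Matrix (Fin w₃ ⊕ Fin (n - w₃)) (Fin c₁ ⊕ Fin ν ⊕ Fin c₃ ⊕ Fin c₄) ℂ :=
    Matrix.fromRows (Matrix.fromCols 0 (Matrix.fromCols 0 (Matrix.fromCols Z₃ Z₄)))
      (Matrix.fromCols Z₁ 0)
  let F : Matrix (Fin n) (Fin (d + 1) × Fin n) ℂ :=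
    lastConst d n - G.submatrix (split hrn).symm id * Zᴴ
  have hF : (lastConst d n - F) * Z = G.submatrix (split hrn).symm id := by
    rw [sub_sub_cancel, Matrix.mul_assoc, hZ.1, Matrix.mul_one]
  let TA := Matrix.fromRows (Qᴴ * shiftConst d n * Z) G
  let TE := Matrix.fromRows (Qᴴ * shiftLin d n * Z)
    (0 : Matrix (Fin w₃ ⊕ Fin (n - w₃)) (Fin c₁ ⊕ Fin ν ⊕ Fin c₃ ⊕ Fin c₄) ℂ)
  let KC : Matrix (Fin m) (Fin c₁ ⊕ Fin ν ⊕ Fin c₃ ⊕ Fin c₄) ℂ :=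
    Matrix.fromCols 0 (Matrix.fromCols 0 (Matrix.fromCols 0 C₄))
  -- the generalized Sylvester equation that separates the finite part from the right Kronecker part
  have hHU : Matrix.fromRows (pencil A₁₁ E₁₁) (const Z₁) =
      pencil (Matrix.fromRows A₁₁ Z₁) (Matrix.fromRows E₁₁ 0) := by
    rw [pencil_fromRows, pencil_zero_right]
  obtain ⟨R₁, L, hRA, hRE⟩ := exists_sylvester (hHU ▸ hU₁) A₂₂ hE₂₂
    (Matrix.fromRows (-A₁₂) 0) (Matrix.fromRows (-E₁₂) 0)
  obtain ⟨L₁, L₂, rfl⟩ : ∃ X Y, L = Matrix.fromRows X Y := ⟨_, _, (Matrix.fromRows_toRows _).symm⟩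
  rw [Matrix.fromRows_mul, Matrix.fromRows_mul] at hRA hRE
  have hRA₁ : A₁₁ * R₁ + A₁₂ = L₁ * A₂₂ := by
    have h1 : A₁₁ * R₁ - L₁ * A₂₂ = -A₁₂ := congrArg Matrix.toRows₁ hRA
    rw [← sub_neg_eq_add, ← h1, sub_sub_cancel]
  have hRE₁ : E₁₁ * R₁ + E₁₂ = L₁ * E₂₂ := by
    have h1 : E₁₁ * R₁ - L₁ * E₂₂ = -E₁₂ := congrArg Matrix.toRows₁ hRE
    rw [← sub_neg_eq_add, ← h1, sub_sub_cancel]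
  have hRA₂ : Z₁ * R₁ = L₂ * A₂₂ := sub_eq_zero.1 (congrArg Matrix.toRows₂ hRA)
  have hRE₂ : L₂ * E₂₂ = 0 := by
    have h1 : (0 : Matrix (Fin (n - w₃)) (Fin c₁) ℂ) * R₁ = L₂ * E₂₂ :=
      sub_eq_zero.1 (congrArg Matrix.toRows₂ hRE)
    rw [← h1, Matrix.zero_mul]
  refine ⟨hrn, ρ₁, ν, ρ₃, c₁, c₃, c₄, A₁₁, E₁₁, A₁₂, E₁₂, A₁₃, E₁₃, A₁₄, E₁₄, A₂₂, E₂₂, A₂₃, E₂₃, A₂₄,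
    E₂₄, A₃₃, E₃₃, A₃₄, E₃₄, C₄, Z₁, Z₃, Z₄, F, Q, Z, pencil TA TE, const KC, hQ, hZ, ?_, ?_, ?_, hzeros,
    hE₂₂, ?_, fun α => ?_, ?_, hU₁, ?_, fun α => ?_, ?_, ?_⟩
  · simp only [TA, TE, hA, hE, G]
    ext1 i j
    rcases i with (i | i | i) | (i | i) <;> rcases j with j | j | j | j <;>
      simp [row4, pencil_apply, const_apply]
  · ext1 i j
    rcases j with j | j | j | j <;> simp [KC, row4, const_apply]
  · rw [transformed_eq, hF, hC]
    ext1 i j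
    rcases i with (i | i) | i <;> rcases j with j | j
    · simp [TA, TE, pencil_apply]
    · simp
    · simp [TA, TE, pencil_apply, const_apply]
    · rcases i with i | i <;> rcases j with j | j <;> simp [Matrix.one_apply]
    · simp [KC]
    · simp
  · refine isUnobservable_pencil (Matrix.fromRows R₁ (Matrix.fromRows 1 0))
      (Matrix.fromRows (Matrix.fromRows L₁ (Matrix.fromRows 1 0)) (Matrix.fromRows 0 L₂))
      (Matrix.fromCols 0 (Matrix.fromCols 1 0))
      (Matrix.fromCols (Matrix.fromCols 0 (Matrix.fromCols 1 0)) 0) rfl ?_ ?_ ?_ ?_ ?_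
    · simp [Matrix.fromCols_mul_fromRows]
    · simp [Matrix.fromCols_mul_fromRows]
    · simp [TA, hA, G, Matrix.fromRows_mul, Matrix.fromBlocks_mul_fromRows,
        Matrix.fromCols_mul_fromRows, hRA₁, hRA₂]
    · simp [TE, hE, Matrix.fromRows_mul, Matrix.fromBlocks_mul_fromRows,
        Matrix.fromCols_mul_fromRows, hRE₁, hRE₂]
    · simp [KC, Matrix.fromCols_mul_fromRows]
  · simpa using rank_eq_of_mulVec_surjective (hA₁₁ α)
  · simpa using rank_eq_of_mulVec_surjective hE₁₁
  · rw [hHU]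
    refine isUnobservable_pencil (Matrix.fromRows 1 0)
      (Matrix.fromRows (Matrix.fromRows (Matrix.fromCols 1 0) 0)
        (Matrix.fromRows 0 (Matrix.fromCols 0 1)))
      (Matrix.fromCols 1 0)
      (Matrix.fromRows (Matrix.fromCols (Matrix.fromCols 1 0) 0)
        (Matrix.fromCols 0 (Matrix.fromCols 0 1))) hU₁.card_eq ?_ ?_ ?_ ?_ ?_
    · simp [Matrix.fromCols_mul_fromRows]
    · simp [Matrix.fromBlocks_mul_fromRows, Matrix.fromCols_mul_fromRows,
        Matrix.fromRows_fromCols_eq_fromBlocks]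
    · simp [TA, hA, G, Matrix.fromRows_mul, Matrix.fromBlocks_mul_fromRows,
        Matrix.fromCols_mul_fromRows]
    · simp [TE, hE, Matrix.fromRows_mul, Matrix.fromBlocks_mul_fromRows,
        Matrix.fromCols_mul_fromRows]
    · simp [KC, Matrix.fromCols_mul_fromRows]
  · have h1 := rank_eq_of_mulVec_injective (hinj α)
    rw [Fintype.card_sum, Fintype.card_fin, Fintype.card_fin] at h1
    rw [← h1]
    congr 1
    ext i j
    rcases i with i | i <;> rcases j with j | j <;> simp
  · simpa using rank_eq_of_mulVec_injective hC₄
  · convert hU₃ using 1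
    ext1 i j
    rcases i with i | i <;> rcases j with j | j <;> simp [pencil_apply, const_apply]
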